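/- Let $\mathcal G$ be a connected, non-compact metric graph with finitely many vertices and edges, each edge $e$ being identified either with a bounded interval $[0,|e|]$, $|e|>0$, or with a half-line $[0,+\infty)$; self-loops and multiple edges are allowed. Assume that $\mathcal G$ has at least one half-line and at least one bounded edge, and let $K$ (the compact core) be the union of the bounded edges. Let $H^1(\mathcal G)$ be the space of real-valued continuous functions on $\mathcal G$ whose restriction to every edge $e$ belongs to $H^1(e)$, with norm $\|u\|_{H^1}^2=\int_{\mathcal G}|u|^2+\int_{\mathcal G}|u'|^2$. For $\mu>0$ put $$H^1_\mu(\mathcal G)=\Big\{u\in H^1(\mathcal G):\ \int_{\mathcal G}|u|^2=\mu\Big\},\qquad E(u)=\frac12\int_{\mathcal G}|u'|^2-\frac16\int_{\mathcal G}|u|^6 .$$ The critical mass of a non-compact graph $\mathcal G$ is $\mu_{\mathcal G}=\sqrt{3/C_{\mathcal G}}$, where $C_{\mathcal G}$ is the best constant in the Gagliardo–Nirenberg inequality $\|u\|_{L^6(\mathcal G)}^6\le C\,\|u\|_{L^2(\mathcal G)}^4\|u'\|_{L^2(\mathcal G)}^2$, $u\in H^1(\mathcal G)$; $\mu_{\mathbb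 R^+}$ denotes the critical mass of the half-line $[0,+\infty)$. Let $0<\eta<\mu<\mu_{\mathcal G}$ and $\delta>0$ be such that $\mu-\eta<\mu_{\mathbb R^+}$ and $(1+\delta)\eta<\mu$, and set $$\mathcal A=\Big\{u\in H^1_\mu(\mathcal G):\ \int_K u^2\ge\eta\Big\},\qquad \mathcal B=\Big\{u\in H^1_\mu(\mathcal G):\ \eta\le\int_K u^2\le(1+\delta)\eta\Big\}.$$ If $$-\infty<\inf_{u\in\mathcal A}E(u)<\inf_{u\in\mathcal B}E(u),$$ then there is $u\in\mathcal A$ such that $E(u)=\min_{\mathcal A}E$, such that $u$ is a local minimizer of $E$ on $H^1_\mu(\mathcal G)$ (that is, for some $r>0$, $E(u)\le E(w)$ for every $w\in H^1_\mu(\mathcal G)$ with $\|w-u\|_{H^1}<r$), and such that $u$ is a critical point of $E$ constrained to $H^1_\mu(\mathcal G)$, i.e. $dE(u)[\varphi]=0$ for every $\varphi\in H^1(\mathcal G)$ with $\int_{\mathcal G}u\varphi=0$. -/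

import Mathlib

open MeasureTheory Set

noncomputable section

/-- A metric graph with (finite) vertices `V`, bounded edges `B` and half-lines `H`.
A bounded edge `b` is a copy of `[0, len b]`, with the point `0` glued at the vertex `src b` and the
point `len b` glued at the vertex `tgt b`; a half-line `h` is a copy of `[0, ∞)`, with the point `0`
glued at `base h`. Self-loops and multiple edges are allowed. -/
structure MetricGraph (V B H : Type*) where
  /-- initial vertex of a bounded edge -/
  src : B → V
  /-- final vertex of a bounded edge -/
  tgt : B → V
  /-- length of a bounded edge -/
  len : B → ℝ
  len_pos : ∀ b, 0 < len b
  /-- initial vertex of a half-line -/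
  base : H → V

namespace MetricGraph

/-- The half-line `ℝ⁺ = [0, ∞)`: one vertex, no bounded edge, one half-line. -/
def halfLine : MetricGraph Unit Empty Unit where
  src := fun _ => ()
  tgt := fun _ => ()
  len := fun _ => 1
  len_pos := fun _ => one_pos
  base := fun _ => ()

variable {V B H : Type*} (G : MetricGraph V B H)

/-- Connectedness: there is a vertex, and any two vertices are joined by a chain of bounded edges
(a half-line has a single finite end point, so it never joins two distinct vertices). -/
def Connected : Prop :=
  Nonempty V ∧ ∀ v w : V, Relation.EqvGen (fun x y => ∃ b, G.src b = x ∧ G.tgt b = y) v w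

/-- The interval with which an edge (bounded, or a half-line) is identified. -/
def dom : B ⊕ H → Set ℝ
  | Sum.inl b => Icc 0 (G.len b)
  | Sum.inr _ => Ici 0

/-- `u` takes a single value at each vertex. Here and below a function on `G` is represented by the
family of its restrictions to the edges; the values outside the intervals `G.dom e` play no role. -/
def ContinuousAtVertices (u : B ⊕ H → ℝ → ℝ) : Prop :=
  ∃ c : V → ℝ,
    (∀ b, u (Sum.inl b) 0 = c (G.src b) ∧ u (Sum.inl b) (G.len b) = c (G.tgt b)) ∧
    ∀ h, u (Sum.inr h) 0 = c (G.base h)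

/-- The (continuous representatives of the elements of the) Sobolev space `H¹(I)`, where `I ∋ 0` is
an interval of the form `[0, L]` or `[0, ∞)`: the functions that are absolutely continuous on every
compact interval `[0, T] ⊆ I` and square integrable on `I` together with their derivative. -/
def MemSobolev (I : Set ℝ) (f : ℝ → ℝ) : Prop :=
  (∀ T ∈ I, AbsolutelyContinuousOnInterval f 0 T) ∧
    MemLp f 2 (volume.restrict I) ∧ MemLp (deriv f) 2 (volume.restrict I)

/-- The space `H¹(G)`: functions on `G` that are continuous and in `H¹` of every edge. -/
def H1 : Set (B ⊕ H → ℝ → ℝ) :=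
  {u | (∀ e, MemSobolev (G.dom e) (u e)) ∧ G.ContinuousAtVertices u}

section Functionals

variable [Fintype B] [Fintype H]

/-- The integral over `G` of a function on `G`. -/
def integral (f : B ⊕ H → ℝ → ℝ) : ℝ := ∑ e, ∫ x in G.dom e, f e x

/-- The mass `∫_G |u|²`. -/
def mass (u : B ⊕ H → ℝ → ℝ) : ℝ := G.integral fun e x => |u e x| ^ 2

/-- `∫_G |u'|²`. -/
def derivSq (u : B ⊕ H → ℝ → ℝ) : ℝ := G.integral fun e x => |deriv (u e) x| ^ 2

/-- `∫_G |u|⁶`. -/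
def powSix (u : B ⊕ H → ℝ → ℝ) : ℝ := G.integral fun e x => |u e x| ^ 6

/-- The energy `E(u, G) = 1/2 ∫_G |u'|² - 1/6 ∫_G |u|⁶`. -/
def energy (u : B ⊕ H → ℝ → ℝ) : ℝ := 1 / 2 * G.derivSq u - 1 / 6 * G.powSix u

/-- The `H¹(G)`-norm. -/
def h1Norm (u : B ⊕ H → ℝ → ℝ) : ℝ := Real.sqrt (G.mass u + G.derivSq u)

/-- The mass `∫_K |u|²` on the compact core `K`, the union of the bounded edges. -/
def coreMass (u : B ⊕ H → ℝ → ℝ) : ℝ := ∑ b : B, ∫ x in Icc 0 (G.len b), |u (Sum.inl b) x| ^ 2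

/-- The best constant `C` in the Gagliardo–Nirenberg inequality
`‖u‖₆⁶ ≤ C ‖u‖₂⁴ ‖u'‖₂²` on `H¹(G)`. -/
def gnConst : ℝ :=
  sInf {C : ℝ | 0 ≤ C ∧ ∀ u ∈ G.H1, G.powSix u ≤ C * G.mass u ^ 2 * G.derivSq u}

/-- The critical mass `μ_G`, for which `3 / μ_G²` is the best constant in the Gagliardo–Nirenberg
inequality. (If no constant is admissible, as on a compact graph, the value is `0`.) -/
def criticalMass : ℝ := Real.sqrt (3 / G.gnConst)

/-- The constraint `H¹_μ(G)`: functions in `H¹(G)` of mass `μ`. -/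
def H1mass (μ : ℝ) : Set (B ⊕ H → ℝ → ℝ) := {u | u ∈ G.H1 ∧ G.mass u = μ}

/-- The functions in `H¹_μ(G)` whose mass on the compact core is at least `η`. -/
def setA (μ η : ℝ) : Set (B ⊕ H → ℝ → ℝ) := {u | u ∈ G.H1mass μ ∧ η ≤ G.coreMass u}

/-- The functions in `H¹_μ(G)` whose mass on the compact core lies in `[η, (1 + δ) η]`. -/
def setB (μ η δ : ℝ) : Set (B ⊕ H → ℝ → ℝ) :=
  {u | u ∈ G.H1mass μ ∧ η ≤ G.coreMass u ∧ G.coreMass u ≤ (1 + δ) * η}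

/-- `u` is a critical point of the energy constrained to `H¹_μ(G)`: the differential of the energy
at `u` vanishes on the tangent space `{φ ∈ H¹(G) : ∫_G u φ = 0}` of `H¹_μ(G)` at `u`. -/
def IsConstrainedCritical (μ : ℝ) (u : B ⊕ H → ℝ → ℝ) : Prop :=
  u ∈ G.H1mass μ ∧ ∀ φ ∈ G.H1, G.integral (fun e x => u e x * φ e x) = 0 →
    HasDerivAt (fun t : ℝ => G.energy (u + t • φ)) 0 0

/-- `u` is a local minimizer of the energy on `H¹_μ(G)`, with respect to the `H¹(G)`-norm. -/
def IsConstrainedLocalMin (μ : ℝ) (u : B ⊕ H → ℝ → ℝ) : Prop :=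
  u ∈ G.H1mass μ ∧ ∃ r > 0, ∀ w ∈ G.H1mass μ, G.h1Norm (w - u) < r → G.energy u ≤ G.energy w

end Functionals

end MetricGraph

end

open Filter Topology

/-! The direct method works because two features defeat loss of mass at infinity. Since `μ` is below
the critical mass of `G`, Gagliardo–Nirenberg makes `E` coercive, so a minimizing sequence in `A` is
bounded in `H¹` and has a weak limit `w`. Convergence is strong in `L²` and `L⁶` on the compact
core, so `w` keeps core mass at least `η`. The remainders `u_i - w` therefore carry asymptotically
at most `μ - η` of mass on the half-lines, which is below the critical mass of `ℝ⁺`, so their energy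
is asymptotically nonnegative. Mass, derivative and `L⁶` integrals split in the Brezis–Lieb manner,
whence `E(w) ≤ inf E` (`exists_limit_splitting`, `exists_limit_energy_le`).

It remains to see that `w` has mass `μ` and lies in the interior of the constraint. Missing mass can
be added on a half-line, widely spread, at arbitrarily small cost in energy and without touching the
core (`exists_add_mass`). Hence `w` also minimizes among functions of mass at most `μ`, and the
strict gap to the infimum over `B` forces its core mass above `(1 + δ)η`. If its mass were less than
`μ`, both slight dilations and slight contractions of `w` would be admissible; strict concavity of
the energy in the squared amplitude then contradicts minimality (`mass_eq_of_energy_le`). The core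
constraint is thus inactive, which gives local minimality and criticality. -/

namespace MetricGraph

/-! ### Edges and the functionals on one edge -/

/-- The intervals `[0, L]`, `L > 0`, and `[0, ∞)`. -/
def IsEdge (I : Set ℝ) : Prop := (∃ L, 0 < L ∧ I = Icc 0 L) ∨ I = Ici 0

lemma IsEdge.measurableSet {I : Set ℝ} (hI : IsEdge I) : MeasurableSet I := by
  rcases hI with ⟨L, _, rfl⟩ | rfl
  exacts [measurableSet_Icc, measurableSet_Ici]

lemma IsEdge.zero_mem {I : Set ℝ} (hI : IsEdge I) : (0 : ℝ) ∈ I := by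
  rcases hI with ⟨L, hL, rfl⟩ | rfl
  exacts [⟨le_rfl, hL.le⟩, le_rfl (a := (0 : ℝ))]

lemma IsEdge.nonneg {I : Set ℝ} (hI : IsEdge I) {x : ℝ} (hx : x ∈ I) : 0 ≤ x := by
  rcases hI with ⟨L, hL, rfl⟩ | rfl
  exacts [hx.1, hx]

lemma IsEdge.Icc_subset {I : Set ℝ} (hI : IsEdge I) {T : ℝ} (hT : T ∈ I) : Icc 0 T ⊆ I := by
  rcases hI with ⟨L, hL, rfl⟩ | rfl
  exacts [Icc_subset_Icc_right hT.2, fun x hx => hx.1]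

/-- The length `ℓ` does not depend on the point, so averaging over these intervals gives a uniform
sup bound. -/
lemma IsEdge.exists_subinterval {I : Set ℝ} (hI : IsEdge I) :
    ∃ ℓ > 0, ∀ x ∈ I, ∃ a, 0 ≤ a ∧ x ∈ Icc a (a + ℓ) ∧ a + ℓ ∈ I := by
  rcases hI with ⟨L, hL, rfl⟩ | rfl
  · exact ⟨L, hL, fun x hx => ⟨0, le_rfl, by simpa using hx, by simpa using hL.le⟩⟩
  · refine ⟨1, one_pos, fun x hx => ⟨x, hx, by simp, ?_⟩⟩
    simp only [mem_Ici] at hx ⊢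
    linarith

lemma isEdge_dom {V B H : Type*} (G : MetricGraph V B H) (e : B ⊕ H) : IsEdge (G.dom e) := by
  rcases e with b | h
  exacts [Or.inl ⟨_, G.len_pos b, rfl⟩, Or.inr rfl]

/-- `∫_I |f|²`. -/
noncomputable def edgeMass (I : Set ℝ) (f : ℝ → ℝ) : ℝ := ∫ x in I, |f x| ^ 2

/-- `∫_I |f'|²`. -/
noncomputable def edgeDerivSq (I : Set ℝ) (f : ℝ → ℝ) : ℝ := ∫ x in I, |deriv f x| ^ 2

/-- `∫_I |f|⁶`. -/
noncomputable def edgePowSix (I : Set ℝ) (f : ℝ → ℝ) : ℝ := ∫ x in I, |f x| ^ 6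

lemma edgeMass_nonneg (I : Set ℝ) (f : ℝ → ℝ) : 0 ≤ edgeMass I f :=
  integral_nonneg fun _ => by positivity

lemma edgeDerivSq_nonneg (I : Set ℝ) (f : ℝ → ℝ) : 0 ≤ edgeDerivSq I f :=
  integral_nonneg fun _ => by positivity

lemma edgePowSix_nonneg (I : Set ℝ) (f : ℝ → ℝ) : 0 ≤ edgePowSix I f :=
  integral_nonneg fun _ => by positivity

/-! ### Quadratic expansion and Cauchy–Schwarz -/

section CauchySchwarz

variable {α : Type*} [MeasurableSpace α] {ν : Measure α} {f g : α → ℝ}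

lemma integrable_mul_of_memLp (hf : MemLp f 2 ν) (hg : MemLp g 2 ν) :
    Integrable (fun x => f x * g x) ν :=
  MemLp.integrable_mul hf hg

lemma integrable_sq_of_memLp (hf : MemLp f 2 ν) : Integrable (fun x => |f x| ^ 2) ν := by
  simpa only [sq_abs] using hf.integrable_sq

lemma integral_sq_add_mul (hf : MemLp f 2 ν) (hg : MemLp g 2 ν) (t : ℝ) :
    ∫ x, |f x + t * g x| ^ 2 ∂ν =
      (∫ x, |f x| ^ 2 ∂ν) + 2 * t * (∫ x, f x * g x ∂ν) + t ^ 2 * ∫ x, |g x| ^ 2 ∂ν := by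
  have h1 := integrable_sq_of_memLp hf
  have h2 := integrable_sq_of_memLp hg
  have h3 := integrable_mul_of_memLp hf hg
  have h4 : Integrable (fun x => |f x| ^ 2 + 2 * t * (f x * g x)) ν := h1.add (h3.const_mul _)
  rw [← integral_const_mul, ← integral_const_mul, ← integral_add h1 (h3.const_mul _),
    ← integral_add h4 (h2.const_mul _)]
  refine integral_congr_ae (.of_forall fun x => ?_)
  simp only [sq_abs]
  ring

/-- The quadratic `t ↦ ∫ |f + t g|²` is nonnegative, so its discriminant is not positive. -/
lemma sq_integral_mul_le (hf : MemLp f 2 ν) (hg : MemLp g 2 ν) :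
    (∫ x, f x * g x ∂ν) ^ 2 ≤ (∫ x, |f x| ^ 2 ∂ν) * ∫ x, |g x| ^ 2 ∂ν := by
  have h : ∀ t : ℝ, 0 ≤ (∫ x, |g x| ^ 2 ∂ν) * (t * t) + (2 * ∫ x, f x * g x ∂ν) * t
      + ∫ x, |f x| ^ 2 ∂ν := by
    intro t
    have := integral_sq_add_mul hf hg t
    have h0 : 0 ≤ ∫ x, |f x + t * g x| ^ 2 ∂ν := integral_nonneg fun _ => by positivity
    linarith [this]
  have := discrim_le_zero h
  rw [discrim] at this
  linarith

end CauchySchwarz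

/-! ### Sobolev functions on an edge -/

section Sobolev

variable {I : Set ℝ} {f g : ℝ → ℝ}

lemma MemSobolev.ae_differentiableAt (hI : IsEdge I) (hf : MemSobolev I f) :
    ∀ᵐ x ∂volume.restrict I, DifferentiableAt ℝ f x := by
  rw [ae_restrict_iff' hI.measurableSet]
  rcases hI with ⟨L, hL, rfl⟩ | rfl
  · have := (hf.1 L ⟨hL.le, le_rfl⟩).ae_differentiableAt
    rwa [uIcc_of_le hL.le] at this
  · have : ∀ n : ℕ, ∀ᵐ x : ℝ, x ∈ uIcc (0 : ℝ) n → DifferentiableAt ℝ f x := fun n =>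
      (hf.1 n (mem_Ici.2 n.cast_nonneg)).ae_differentiableAt
    filter_upwards [ae_all_iff.2 this] with x hx hx0
    obtain ⟨n, hn⟩ := exists_nat_ge x
    exact hx n (by rw [uIcc_of_le n.cast_nonneg]; exact ⟨hx0, hn⟩)

lemma MemSobolev.deriv_add_smul (hI : IsEdge I) (hf : MemSobolev I f) (hg : MemSobolev I g)
    (t : ℝ) : deriv (f + t • g) =ᵐ[volume.restrict I] fun x => deriv f x + t * deriv g x := by
  filter_upwards [hf.ae_differentiableAt hI, hg.ae_differentiableAt hI] with x h1 h2
  rw [deriv_add h1 (h2.const_smul t), deriv_const_smul _ h2, smul_eq_mul]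

lemma MemSobolev.add_smul (hI : IsEdge I) (hf : MemSobolev I f) (hg : MemSobolev I g) (t : ℝ) :
    MemSobolev I (f + t • g) := by
  refine ⟨fun T hT => (hf.1 T hT).add ((hg.1 T hT).const_smul t),
    hf.2.1.add (hg.2.1.const_smul t), ?_⟩
  rw [memLp_congr_ae (hf.deriv_add_smul hI hg t)]
  exact hf.2.2.add (hg.2.2.const_mul t)

lemma memSobolev_zero (I : Set ℝ) : MemSobolev I 0 := by
  refine ⟨fun T _ => ?_, MemLp.zero, ?_⟩
  · exact contDiff_const.contDiffOn.absolutelyContinuousOnInterval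
  · have : deriv (0 : ℝ → ℝ) = 0 := by ext x; simp
    rw [this]
    exact MemLp.zero

lemma MemSobolev.smul (hI : IsEdge I) (hf : MemSobolev I f) (t : ℝ) : MemSobolev I (t • f) := by
  simpa using (memSobolev_zero I).add_smul hI hf t

lemma MemSobolev.sub (hI : IsEdge I) (hf : MemSobolev I f) (hg : MemSobolev I g) :
    MemSobolev I (f - g) := by
  simpa [sub_eq_add_neg] using hf.add_smul hI hg (-1)

lemma edgeMass_add_smul (hf : MemSobolev I f) (hg : MemSobolev I g) (t : ℝ) :
    edgeMass I (f + t • g) =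
      edgeMass I f + 2 * t * (∫ x in I, f x * g x) + t ^ 2 * edgeMass I g :=
  integral_sq_add_mul hf.2.1 hg.2.1 t

lemma edgeDerivSq_add_smul (hI : IsEdge I) (hf : MemSobolev I f) (hg : MemSobolev I g) (t : ℝ) :
    edgeDerivSq I (f + t • g) =
      edgeDerivSq I f + 2 * t * (∫ x in I, deriv f x * deriv g x) + t ^ 2 * edgeDerivSq I g := by
  rw [edgeDerivSq, edgeDerivSq, edgeDerivSq, ← integral_sq_add_mul hf.2.2 hg.2.2 t]
  refine integral_congr_ae ?_
  filter_upwards [hf.deriv_add_smul hI hg t] with x hx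
  rw [hx]

/-- The fundamental theorem of calculus and Cauchy–Schwarz against the constant `1`. This Hölder-1/2
bound supplies the equicontinuity used for compactness. -/
lemma MemSobolev.sq_sub_le (hI : IsEdge I) (hf : MemSobolev I f) {x y : ℝ} (hx : x ∈ I)
    (hy : y ∈ I) : (f x - f y) ^ 2 ≤ edgeDerivSq I f * |x - y| := by
  wlog hxy : y ≤ x generalizing x y
  · have := this hy hx (le_of_not_ge hxy)
    rwa [abs_sub_comm, ← neg_sub, neg_sq] at this
  have hy0 := hI.nonneg hy
  have hsub : Ioc y x ⊆ I := fun z hz => hI.Icc_subset hx ⟨hy0.trans hz.1.le, hz.2⟩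
  have hac : AbsolutelyContinuousOnInterval f y x :=
    (hf.1 x hx).mono (by
      rw [uIcc_of_le hxy, uIcc_of_le (hy0.trans hxy)]
      exact Icc_subset_Icc_left hy0)
  rw [← hac.integral_deriv_eq_sub, intervalIntegral.integral_of_le hxy]
  have hd : MemLp (deriv f) 2 (volume.restrict (Ioc y x)) :=
    hf.2.2.mono_measure (Measure.restrict_mono hsub le_rfl)
  have h1 := sq_integral_mul_le hd (memLp_const (1 : ℝ))
  simp only [mul_one, abs_one, one_pow] at h1
  refine h1.trans ?_
  have h2 : ∫ x in Ioc y x, |deriv f x| ^ 2 ≤ edgeDerivSq I f :=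
    setIntegral_mono_set (integrable_sq_of_memLp hf.2.2) (.of_forall fun _ => by positivity)
      (LE.le.eventuallyLE hsub)
  have h3 : ∫ _ in Ioc y x, (1 : ℝ) = |x - y| := by
    simp [hxy, abs_of_nonneg (sub_nonneg.2 hxy)]
  rw [h3]
  exact mul_le_mul_of_nonneg_right h2 (abs_nonneg _)

lemma IsEdge.exists_sup_bound (hI : IsEdge I) : ∃ K, 0 ≤ K ∧ ∀ f, MemSobolev I f → ∀ x ∈ I,
    f x ^ 2 ≤ K * (edgeMass I f + edgeDerivSq I f) := by
  obtain ⟨ℓ, hℓ, h⟩ := hI.exists_subinterval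
  refine ⟨2 / ℓ + 2 * ℓ, by positivity, fun f hf x hx => ?_⟩
  obtain ⟨a, ha, hxa, haI⟩ := h x hx
  have hsub : Icc a (a + ℓ) ⊆ I := (Icc_subset_Icc_left ha).trans (hI.Icc_subset haI)
  have hsq := integrable_sq_of_memLp hf.2.1
  have hd := edgeDerivSq_nonneg I f
  -- Uses `f(x)² ≤ 2 f(y)² + 2 (f(x) - f(y))²`; integrating over `y` then bounds `f(x)²`.
  have h1 : ∀ y ∈ Icc a (a + ℓ), f x ^ 2 ≤ 2 * |f y| ^ 2 + 2 * (ℓ * edgeDerivSq I f) := by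
    intro y hy
    have h2 := hf.sq_sub_le hI hx (hsub hy)
    have h3 : |x - y| ≤ ℓ := by
      rw [abs_le]
      constructor <;> linarith [hxa.1, hxa.2, hy.1, hy.2]
    have h4 : edgeDerivSq I f * |x - y| ≤ edgeDerivSq I f * ℓ := mul_le_mul_of_nonneg_left h3 hd
    rw [sq_abs]
    nlinarith [sq_nonneg (f x - 2 * f y)]
  have hint : IntegrableOn (fun y => |f y| ^ 2) (Icc a (a + ℓ)) := IntegrableOn.mono_set hsq hsub
  have h5 : ∫ _ in Icc a (a + ℓ), f x ^ 2 ≤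
      ∫ y in Icc a (a + ℓ), (2 * |f y| ^ 2 + 2 * (ℓ * edgeDerivSq I f)) :=
    setIntegral_mono_on (integrable_const _) ((hint.const_mul 2).add (integrable_const _))
      measurableSet_Icc h1
  rw [integral_add (hint.const_mul 2) (integrable_const _), integral_const_mul] at h5
  have h6 : ∫ y in Icc a (a + ℓ), |f y| ^ 2 ≤ edgeMass I f :=
    setIntegral_mono_set hsq (.of_forall fun _ => by positivity)
      (LE.le.eventuallyLE hsub)
  simp only [integral_const, MeasurableSet.univ, measureReal_restrict_apply, univ_inter,
    Real.volume_real_Icc, add_sub_cancel_left, max_eq_left hℓ.le, smul_eq_mul] at h5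
  have hm := edgeMass_nonneg I f
  have h7 : ℓ * f x ^ 2 ≤ ℓ * ((2 / ℓ + 2 * ℓ) * (edgeMass I f + edgeDerivSq I f)) := by
    have : ℓ * ((2 / ℓ + 2 * ℓ) * (edgeMass I f + edgeDerivSq I f)) =
      (2 + 2 * ℓ ^ 2) * (edgeMass I f + edgeDerivSq I f) := by field_simp
    rw [this]
    nlinarith [mul_nonneg (sq_nonneg ℓ) hm]
  exact le_of_mul_le_mul_left h7 hℓ

lemma MemSobolev.exists_bound (hI : IsEdge I) (hf : MemSobolev I f) :
    ∃ S, 0 ≤ S ∧ ∀ x ∈ I, |f x| ≤ S := by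
  obtain ⟨K, _, h⟩ := hI.exists_sup_bound
  exact ⟨_, Real.sqrt_nonneg _, fun x hx => Real.abs_le_sqrt (h f hf x hx)⟩

lemma abs_pow_mul_pow_le {a b S : ℝ} (ha : |a| ≤ S) (hb : |b| ≤ S) (i j r : ℕ)
    (h : i + j = r + 2) : |a ^ i * b ^ j| ≤ S ^ r * (|a| ^ 2 + |b| ^ 2) := by
  have hm : max |a| |b| ≤ S := max_le ha hb
  have h0 : 0 ≤ max |a| |b| := (abs_nonneg a).trans (le_max_left _ _)
  calc |a ^ i * b ^ j| = |a| ^ i * |b| ^ j := by rw [abs_mul, abs_pow, abs_pow]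
    _ ≤ max |a| |b| ^ i * max |a| |b| ^ j := by
        gcongr
        exacts [le_max_left _ _, le_max_right _ _]
    _ = max |a| |b| ^ r * max |a| |b| ^ 2 := by rw [← pow_add, ← pow_add, h]
    _ ≤ S ^ r * (|a| ^ 2 + |b| ^ 2) := by
        refine mul_le_mul (pow_le_pow_left₀ h0 hm r) ?_ (by positivity)
          (pow_nonneg (h0.trans hm) r)
        rcases max_choice |a| |b| with h | h <;> rw [h]
        · linarith [sq_nonneg |b|]
        · linarith [sq_nonneg |a|]

lemma MemSobolev.integrable_pow_mul_pow (hI : IsEdge I) (hf : MemSobolev I f)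
    (hg : MemSobolev I g) {i j : ℕ} (r : ℕ) (h : i + j = r + 2) :
    Integrable (fun x => f x ^ i * g x ^ j) (volume.restrict I) := by
  obtain ⟨S, hS, hfS⟩ := hf.exists_bound hI
  obtain ⟨S', hS', hgS⟩ := hg.exists_bound hI
  refine Integrable.mono' (g := fun x => (S + S') ^ r * (|f x| ^ 2 + |g x| ^ 2))
    (((integrable_sq_of_memLp hf.2.1).add (integrable_sq_of_memLp hg.2.1)).const_mul _)
    ((hf.2.1.1.pow i).mul (hg.2.1.1.pow j)) ?_
  filter_upwards [ae_restrict_mem hI.measurableSet] with x hx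
  exact abs_pow_mul_pow_le ((hfS x hx).trans (by linarith)) ((hgS x hx).trans (by linarith)) i j r h

lemma MemSobolev.integrable_pow_six (hI : IsEdge I) (hf : MemSobolev I f) :
    Integrable (fun x => |f x| ^ 6) (volume.restrict I) := by
  have := hf.integrable_pow_mul_pow hI hf (i := 6) (j := 0) 4 rfl
  simpa [Even.pow_abs (show Even 6 by decide)] using this

/-- Since the energy is polynomial along lines, its differentiability needs no differentiation under
the integral. -/
lemma exists_polynomial_edgePowSix (hI : IsEdge I) (hf : MemSobolev I f) (hg : MemSobolev I g) :
    ∃ p : Polynomial ℝ, ∀ t : ℝ, edgePowSix I (f + t • g) = p.eval t := by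
  refine ⟨∑ k ∈ Finset.range 7, Polynomial.C (∫ x in I, f x ^ k * g x ^ (6 - k) * (Nat.choose 6 k))
    * Polynomial.X ^ (6 - k), fun t => ?_⟩
  have h : ∀ x, |(f + t • g) x| ^ 6 =
      ∑ k ∈ Finset.range 7, (f x ^ k * g x ^ (6 - k) * (Nat.choose 6 k)) * t ^ (6 - k) := by
    intro x
    rw [Even.pow_abs (by decide), Pi.add_apply, Pi.smul_apply, smul_eq_mul, add_pow]
    refine Finset.sum_congr rfl fun k _ => ?_
    rw [mul_pow]
    ring
  simp only [edgePowSix, h, Polynomial.eval_finsetSum, Polynomial.eval_mul, Polynomial.eval_C,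
    Polynomial.eval_pow, Polynomial.eval_X]
  rw [integral_finsetSum]
  · simp only [integral_mul_const]
  · intro k hk
    refine Integrable.mul_const (Integrable.mul_const ?_ _) _
    refine hf.integrable_pow_mul_pow hI hg 4 ?_
    have := Finset.mem_range.1 hk
    omega

lemma edgePowSix_smul (t : ℝ) : edgePowSix I (t • f) = t ^ 6 * edgePowSix I f := by
  rw [edgePowSix, edgePowSix, ← integral_const_mul]
  refine integral_congr_ae (.of_forall fun x => ?_)
  simp only [Pi.smul_apply, smul_eq_mul, abs_mul, mul_pow]
  rw [Even.pow_abs (by decide)]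

end Sobolev

/-! ### Compactness along an ultrafilter -/

/-- Banach–Alaoglu in the dual, transported by the Riesz isometry. An ultrafilter makes bounded
families converge without extracting subsequences. -/
lemma exists_weak_limit {E ι : Type*} [NormedAddCommGroup E] [InnerProductSpace ℝ E]
    [CompleteSpace E] (l : Ultrafilter ι) (g : ι → E) {R : ℝ} (hg : ∀ i, ‖g i‖ ≤ R) :
    ∃ a : E, ∀ f : E, Tendsto (fun i => inner ℝ (g i) f) l (𝓝 (inner ℝ a f)) := by
  have hc := WeakDual.isCompact_closedBall (𝕜 := ℝ) (E := E) 0 R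
  rw [isCompact_iff_ultrafilter_le_nhds] at hc
  let F : ι → WeakDual ℝ E := fun i => StrongDual.toWeakDual (InnerProductSpace.toDual ℝ E (g i))
  obtain ⟨φ, -, hφ⟩ := hc (l.map F) (by
    rw [Ultrafilter.coe_map, le_principal_iff]
    refine mem_map.2 (univ_mem' fun i => ?_)
    simp only [F, mem_preimage, Metric.mem_closedBall, dist_zero_right]
    exact ((InnerProductSpace.toDual ℝ E).norm_map (g i)).trans_le (hg i))
  refine ⟨(InnerProductSpace.toDual ℝ E).symm (WeakDual.toStrongDual φ), fun f => ?_⟩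
  rw [InnerProductSpace.toDual_symm_apply]
  have h1 : Tendsto (fun ψ : WeakDual ℝ E => ψ f) (𝓝 φ) (𝓝 (φ f)) :=
    (WeakDual.eval_continuous f).tendsto φ
  exact h1.comp hφ

lemma exists_weak_limit_memLp {α ι : Type*} [MeasurableSpace α] {ν : Measure α}
    (l : Ultrafilter ι) {g : ι → α → ℝ} (hg : ∀ i, MemLp (g i) 2 ν) {M : ℝ}
    (hM : ∀ i, ∫ x, |g i x| ^ 2 ∂ν ≤ M) :
    ∃ a : α → ℝ, MemLp a 2 ν ∧ ∀ f, MemLp f 2 ν →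
      Tendsto (fun i => ∫ x, f x * g i x ∂ν) l (𝓝 (∫ x, f x * a x ∂ν)) := by
  have key : ∀ {a b : α → ℝ} (ha : MemLp a 2 ν) (hb : MemLp b 2 ν),
      inner ℝ (ha.toLp a) (hb.toLp b) = ∫ x, b x * a x ∂ν := by
    intro a b ha hb
    rw [L2.inner_def]
    refine integral_congr_ae ?_
    filter_upwards [ha.coeFn_toLp, hb.coeFn_toLp] with x h1 h2
    rw [h1, h2]
    simp
  obtain ⟨a, ha⟩ := exists_weak_limit l (fun i => (hg i).toLp (g i)) (R := Real.sqrt M) (by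
    intro i
    refine Real.le_sqrt_of_sq_le ?_
    rw [← real_inner_self_eq_norm_sq, key]
    refine le_trans (le_of_eq ?_) (hM i)
    exact integral_congr_ae (.of_forall fun x => ((sq_abs _).trans (sq _)).symm))
  have ha' : MemLp a 2 ν := Lp.memLp a
  refine ⟨a, ha', fun f hf => ?_⟩
  have h := ha (hf.toLp f)
  rw [← Lp.toLp_coeFn a ha', key] at h
  simpa only [key] using h

/-- Equi-Hölder functions that converge pointwise on `[0, T]` converge uniformly there. -/
lemma tendstoUniformlyOn_of_sq_sub_le {ι : Type*} {l : Filter ι} [NeBot l] {u : ι → ℝ → ℝ}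
    {w : ℝ → ℝ} {T M : ℝ}
    (hu : ∀ i, ∀ x ∈ Icc 0 T, ∀ y ∈ Icc 0 T, (u i x - u i y) ^ 2 ≤ M * |x - y|)
    (hw : ∀ x ∈ Icc 0 T, Tendsto (fun i => u i x) l (𝓝 (w x))) :
    TendstoUniformlyOn u w l (Icc 0 T) := by
  have hwH : ∀ x ∈ Icc 0 T, ∀ y ∈ Icc 0 T, (w x - w y) ^ 2 ≤ M * |x - y| := fun x hx y hy =>
    le_of_tendsto (((hw x hx).sub (hw y hy)).pow 2) (.of_forall fun i => hu i x hx y hy)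
  rw [Metric.tendstoUniformlyOn_iff]
  intro ε hε
  have hM0 : 0 < |M| + 1 := by positivity
  have hδ : 0 < (ε / 3) ^ 2 / (|M| + 1) := by positivity
  -- Pointwise convergence on a finite net suffices: the radius makes `u i` and `w` each vary by
  -- less than `ε / 3` within a ball.
  obtain ⟨s, hsub, hsf, hs⟩ := (isCompact_Icc (a := (0 : ℝ)) (b := T)).finite_cover_balls hδ
  have hclose : ∀ x y, x ∈ Metric.ball y ((ε / 3) ^ 2 / (|M| + 1)) → M * |x - y| < (ε / 3) ^ 2 := by
    intro x y hxy
    rw [Metric.mem_ball, Real.dist_eq, lt_div_iff₀ hM0] at hxy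
    nlinarith [le_abs_self M, abs_nonneg (x - y)]
  have hev : ∀ᶠ i in l, ∀ y ∈ s, |u i y - w y| < ε / 3 :=
    (eventually_all_finite hsf).2 fun y hy => by
      simpa [Real.dist_eq] using Metric.tendsto_nhds.1 (hw y (hsub hy)) (ε / 3) (by positivity)
  filter_upwards [hev] with i hi x hx
  obtain ⟨y, hy, hxy⟩ := mem_iUnion₂.1 (hs hx)
  have h1 := abs_lt_of_sq_lt_sq ((hu i x hx y (hsub hy)).trans_lt (hclose x y hxy)) (by positivity)
  have h2 := abs_lt_of_sq_lt_sq ((hwH x hx y (hsub hy)).trans_lt (hclose x y hxy)) (by positivity)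
  have h3 := hi y hy
  rw [Real.dist_eq, abs_lt]
  rw [abs_lt] at h1 h2 h3
  constructor <;> linarith

lemma IsEdge.exists_tail_le {I : Set ℝ} (hI : IsEdge I) {f : ℝ → ℝ}
    (hf : IntegrableOn f I) {ε : ℝ} (hε : 0 < ε) :
    ∃ T ∈ I, ∫ x in I \ Icc 0 T, f x ≤ ε := by
  have hdiff : ∀ T ∈ I, ∫ x in I \ Icc 0 T, f x = (∫ x in I, f x) - ∫ x in Icc 0 T, f x :=
    fun T hT => setIntegral_sdiff measurableSet_Icc hf (hI.Icc_subset hT)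
  rcases hI with ⟨L, hL, rfl⟩ | rfl
  · exact ⟨L, ⟨hL.le, le_rfl⟩, by simpa using hε.le⟩
  · have h := intervalIntegral_tendsto_integral_Ioi 0 (hf.mono_set Ioi_subset_Ici_self)
      tendsto_id
    obtain ⟨T, hT, hT0⟩ := ((h.eventually_const_lt (sub_lt_self _ hε)).and
      (eventually_ge_atTop (0 : ℝ))).exists
    refine ⟨T, hT0, ?_⟩
    rw [hdiff T hT0, integral_Ici_eq_integral_Ioi, integral_Icc_eq_integral_Ioc,
      ← intervalIntegral.integral_of_le hT0]
    simp only [id] at hT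
    linarith

/-- On `[0, T]` the factor `v i` is uniformly small; beyond `T` the mass of `w` is small while that
of `v i` stays bounded. -/
lemma tendsto_integral_abs_mul_abs {ι : Type*} {l : Filter ι} {I : Set ℝ} (hI : IsEdge I)
    {w : ℝ → ℝ} {v : ι → ℝ → ℝ} {M : ℝ} (hw : MemLp w 2 (volume.restrict I))
    (hv : ∀ i, MemLp (v i) 2 (volume.restrict I)) (hM : ∀ i, edgeMass I (v i) ≤ M)
    (h0 : ∀ T ∈ I, TendstoUniformlyOn v 0 l (Icc 0 T)) :
    Tendsto (fun i => ∫ x in I, |w x| * |v i x|) l (𝓝 0) := by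
  rw [Metric.tendsto_nhds]
  intro ε hε
  have hM1 : 0 < |M| + 1 := by positivity
  -- The weight in Young's inequality on the tail: `r (|M| + 1) = ε / 4`, and a tail mass `r * ε` of
  -- `w` costs `ε / 4` after division by `4 r`.
  set r : ℝ := ε / (4 * (|M| + 1)) with hr
  have hr0 : 0 < r := by positivity
  have hw2 := integrable_sq_of_memLp hw
  obtain ⟨T, hT, htail⟩ := hI.exists_tail_le hw2 (ε := r * ε) (by positivity)
  have hsub := hI.Icc_subset hT
  have hwT : IntegrableOn (fun x => |w x|) (Icc 0 T) :=
    ((hw.mono_measure (Measure.restrict_mono hsub le_rfl)).integrable one_le_two).abs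
  have hA0 : 0 ≤ ∫ x in Icc 0 T, |w x| := integral_nonneg fun _ => abs_nonneg _
  have hs0 : 0 < ε / (4 * ((∫ x in Icc 0 T, |w x|) + 1)) := by positivity
  filter_upwards [Metric.tendstoUniformlyOn_iff.1 (h0 T hT) _ hs0] with i hi
  have hv2 := integrable_sq_of_memLp (hv i)
  have hwv : IntegrableOn (fun x => |w x| * |v i x|) I :=
    (integrable_mul_of_memLp hw (hv i)).abs.congr (.of_forall fun x => abs_mul _ _)
  have h1 : ∫ x in Icc 0 T, |w x| * |v i x| ≤ ε / 4 := by
    calc ∫ x in Icc 0 T, |w x| * |v i x|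
        ≤ ∫ x in Icc 0 T, |w x| * (ε / (4 * ((∫ x in Icc 0 T, |w x|) + 1))) := by
          refine setIntegral_mono_on (hwv.mono_set hsub) (hwT.mul_const _) measurableSet_Icc ?_
          intro x hx
          have := hi x hx
          rw [Pi.zero_apply, dist_zero_left, Real.norm_eq_abs] at this
          exact mul_le_mul_of_nonneg_left this.le (abs_nonneg _)
      _ = (∫ x in Icc 0 T, |w x|) * (ε / (4 * ((∫ x in Icc 0 T, |w x|) + 1))) := by
          rw [integral_mul_const]
      _ ≤ ε / 4 := by
          rw [mul_div_assoc', div_le_div_iff₀ (by positivity) (by norm_num)]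
          nlinarith
  have h2 : ∫ x in I \ Icc 0 T, |w x| * |v i x| ≤ ε / 4 + ε / 4 := by
    have hd : I \ Icc 0 T ⊆ I := sdiff_subset
    calc ∫ x in I \ Icc 0 T, |w x| * |v i x|
        ≤ ∫ x in I \ Icc 0 T, ((1 / (4 * r)) * |w x| ^ 2 + r * |v i x| ^ 2) := by
          refine setIntegral_mono (hwv.mono_set hd) (((hw2.mono_measure
            (Measure.restrict_mono hd le_rfl)).const_mul _).add ((hv2.mono_measure
            (Measure.restrict_mono hd le_rfl)).const_mul _)) fun x => ?_
          have : (1 / (4 * r)) * |w x| ^ 2 + r * |v i x| ^ 2 - |w x| * |v i x| =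
            (|w x| - 2 * r * |v i x|) ^ 2 / (4 * r) := by
            field_simp
            ring
          have h' : 0 ≤ (|w x| - 2 * r * |v i x|) ^ 2 / (4 * r) := by positivity
          change |w x| * |v i x| ≤ (1 / (4 * r)) * |w x| ^ 2 + r * |v i x| ^ 2
          linarith
      _ = (1 / (4 * r)) * (∫ x in I \ Icc 0 T, |w x| ^ 2)
          + r * ∫ x in I \ Icc 0 T, |v i x| ^ 2 := by
          rw [integral_add ((hw2.mono_measure (Measure.restrict_mono hd le_rfl)).const_mul _)
            ((hv2.mono_measure (Measure.restrict_mono hd le_rfl)).const_mul _),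
            integral_const_mul, integral_const_mul]
      _ ≤ (1 / (4 * r)) * (r * ε) + r * (|M| + 1) := by
          gcongr
          refine (setIntegral_mono_set hv2 (.of_forall fun _ => by positivity)
            (LE.le.eventuallyLE hd)).trans ?_
          exact (hM i).trans (by linarith [le_abs_self M])
      _ = ε / 4 + ε / 4 := by
          rw [hr]
          field_simp
  have h3 := setIntegral_sdiff measurableSet_Icc hwv hsub
  have h4 : 0 ≤ ∫ x in I, |w x| * |v i x| := integral_nonneg fun _ => by positivity
  rw [dist_zero_right, Real.norm_of_nonneg h4]
  linarith

lemma memLp_two_of_integral_Icc_le {I : Set ℝ} (hI : IsEdge I) {w : ℝ → ℝ} {C : ℝ}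
    (hc : ∀ T ∈ I, ContinuousOn w (Icc 0 T)) (h : ∀ T ∈ I, ∫ x in Icc 0 T, |w x| ^ 2 ≤ C) :
    MemLp w 2 (volume.restrict I) := by
  have hsq : ∀ T ∈ I, IntegrableOn (fun x => |w x| ^ 2) (Icc 0 T) := fun T hT =>
    ((hc T hT).abs.pow 2).integrableOn_Icc
  have hmeas : AEStronglyMeasurable w (volume.restrict I) := by
    rcases hI with ⟨L, hL, rfl⟩ | rfl
    · exact (hc L ⟨hL.le, le_rfl⟩).aestronglyMeasurable measurableSet_Icc
    · refine ContinuousOn.aestronglyMeasurable (fun x hx => ?_) measurableSet_Ici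
      have hx' : (0 : ℝ) ≤ x := hx
      have h1 := hc (x + 1) (mem_Ici.2 (by linarith)) x ⟨hx', by linarith⟩
      refine h1.mono_of_mem_nhdsWithin ?_
      rw [← Ici_inter_Iic]
      exact inter_mem_nhdsWithin _ (Iic_mem_nhds (by linarith))
  rw [memLp_two_iff_integrable_sq hmeas]
  simp only [sq_abs] at hsq h
  rcases hI with ⟨L, hL, rfl⟩ | rfl
  · exact hsq L ⟨hL.le, le_rfl⟩
  · refine (integrableOn_Ici_iff_integrableOn_Ioi (by finiteness)).2 ?_
    refine integrableOn_Ioi_of_intervalIntegral_norm_bounded (l := atTop)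
      (b := fun n : ℕ => (n : ℝ)) C 0
      (fun n => (hsq n (mem_Ici.2 n.cast_nonneg)).mono_set Ioc_subset_Icc_self)
      tendsto_natCast_atTop_atTop (.of_forall fun n => ?_)
    rw [intervalIntegral.integral_of_le n.cast_nonneg, ← integral_Icc_eq_integral_Ioc]
    simpa using h n (mem_Ici.2 n.cast_nonneg)

/-- The limit is built as the primitive of a weak `L²` limit of the derivatives, starting from the
limit of the values at `0`. -/
lemma exists_sobolev_limit {ι : Type*} {I : Set ℝ} (hI : IsEdge I) (l : Ultrafilter ι)
    {u : ι → ℝ → ℝ} (hu : ∀ i, MemSobolev I (u i)) {M : ℝ} (hm : ∀ i, edgeMass I (u i) ≤ M)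
    (hd : ∀ i, edgeDerivSq I (u i) ≤ M) :
    ∃ w, MemSobolev I w ∧ (∀ x ∈ I, Tendsto (fun i => u i x) l (𝓝 (w x))) ∧
      (∀ T ∈ I, TendstoUniformlyOn u w l (Icc 0 T)) ∧
      ∀ f, MemLp f 2 (volume.restrict I) →
        Tendsto (fun i => ∫ x in I, f x * deriv (u i) x) l (𝓝 (∫ x in I, f x * deriv w x)) := by
  obtain ⟨K, hK, hsup⟩ := hI.exists_sup_bound
  obtain ⟨c, -, hc⟩ := (isCompact_Icc (a := -√(K * (M + M))) (b := √(K * (M + M)))).ultrafilter_le_nhds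
    (l.map fun i => u i 0) (by
      rw [Ultrafilter.coe_map, le_principal_iff]
      refine mem_map.2 (univ_mem' fun i => ?_)
      refine abs_le.1 (Real.abs_le_sqrt ((hsup _ (hu i) 0 hI.zero_mem).trans ?_))
      gcongr
      exacts [hm i, hd i])
  replace hc : Tendsto (fun i => u i 0) l (𝓝 c) := hc
  obtain ⟨a, ha, hweak⟩ := exists_weak_limit_memLp l (fun i => (hu i).2.2) hd
  -- Testing weak convergence against the indicator of `(0, x]` yields convergence of `u i x - u i
  -- 0`.
  have hind : ∀ x ∈ I, ∀ g : ℝ → ℝ,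
      ∫ y in I, (Ioc 0 x).indicator (fun _ => (1 : ℝ)) y * g y = ∫ y in (0 : ℝ)..x, g y := by
    intro x hx g
    have : (fun y => (Ioc 0 x).indicator (fun _ => (1 : ℝ)) y * g y) = (Ioc 0 x).indicator g := by
      ext y
      by_cases hy : y ∈ Ioc 0 x <;> simp [hy]
    rw [this, setIntegral_indicator measurableSet_Ioc,
      inter_eq_self_of_subset_right (Ioc_subset_Icc_self.trans (hI.Icc_subset hx)),
      intervalIntegral.integral_of_le (hI.nonneg hx)]
  have hint : ∀ x ∈ I, IntervalIntegrable a volume 0 x := fun x hx => by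
    rw [intervalIntegrable_iff_integrableOn_Ioc_of_le (hI.nonneg hx)]
    exact (ha.mono_measure (Measure.restrict_mono
      (Ioc_subset_Icc_self.trans (hI.Icc_subset hx)) le_rfl)).integrable one_le_two
  set w : ℝ → ℝ := fun x => c + ∫ t in (0 : ℝ)..x, a t with hwdef
  have hpt : ∀ x ∈ I, Tendsto (fun i => u i x) l (𝓝 (w x)) := by
    intro x hx
    have h1 := hweak ((Ioc 0 x).indicator fun _ => (1 : ℝ))
      (memLp_indicator_const 2 measurableSet_Ioc 1 (Or.inr (by
        rw [Measure.restrict_apply measurableSet_Ioc]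
        exact ((measure_mono inter_subset_left).trans_lt measure_Ioc_lt_top).ne)))
    simp only [hind x hx] at h1
    refine (hc.add h1).congr fun i => ?_
    rw [((hu i).1 x hx).integral_deriv_eq_sub]
    ring
  have hac : ∀ T ∈ I, AbsolutelyContinuousOnInterval w 0 T := fun T hT =>
    (contDiff_const.contDiffOn.absolutelyContinuousOnInterval :
      AbsolutelyContinuousOnInterval (fun _ => c) 0 T).add
      ((hint T hT).absolutelyContinuousOnInterval_intervalIntegral (c := 0) left_mem_uIcc)
  have hderiv : deriv w =ᵐ[volume.restrict I] a := by
    have key : ∀ T ∈ I, ∀ᵐ x : ℝ, x ∈ Icc 0 T → deriv w x = a x := by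
      intro T hT
      filter_upwards [(hint T hT).ae_hasDerivAt_integral] with x hx hxT
      rw [← uIcc_of_le (hI.nonneg hT)] at hxT
      exact ((hx hxT 0 left_mem_uIcc).const_add c).deriv
    rw [EventuallyEq, ae_restrict_iff' hI.measurableSet]
    rcases hI with ⟨L, hL, rfl⟩ | rfl
    · exact key L ⟨hL.le, le_rfl⟩
    · filter_upwards [ae_all_iff.2 fun n : ℕ => key n (mem_Ici.2 n.cast_nonneg)] with x hx hx0
      obtain ⟨n, hn⟩ := exists_nat_ge x
      exact hx n ⟨hx0, hn⟩
  have hunif : ∀ T ∈ I, TendstoUniformlyOn u w l (Icc 0 T) := fun T hT =>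
    tendstoUniformlyOn_of_sq_sub_le (M := M)
      (fun i x hx y hy => ((hu i).sq_sub_le hI (hI.Icc_subset hT hx) (hI.Icc_subset hT hy)).trans
        (mul_le_mul_of_nonneg_right (hd i) (abs_nonneg _)))
      (fun x hx => hpt x (hI.Icc_subset hT hx))
  have hcont : ∀ T ∈ I, ContinuousOn w (Icc 0 T) := fun T hT => by
    simpa [uIcc_of_le (hI.nonneg hT)] using (hac T hT).continuousOn
  have hw2 : MemLp w 2 (volume.restrict I) := by
    refine memLp_two_of_integral_Icc_le hI (C := 2 * M + 2) hcont fun T hT => ?_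
    have hT0 := hI.nonneg hT
    -- Uniform error `1 / √(T + 1)` contributes at most `2` on `[0, T]`, so the bound `2 * M + 2` is
    -- independent of `T`.
    obtain ⟨i, hi⟩ := (Metric.tendstoUniformlyOn_iff.1 (hunif T hT) (1 / √(T + 1))
      (by positivity)).exists
    have hui : IntegrableOn (fun x => |u i x| ^ 2) (Icc 0 T) :=
      IntegrableOn.mono_set (integrable_sq_of_memLp (hu i).2.1) (hI.Icc_subset hT)
    have h1 : ∫ x in Icc 0 T, |w x| ^ 2 ≤
        ∫ x in Icc 0 T, (2 * |u i x| ^ 2 + 2 * (1 / (T + 1))) := by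
      refine setIntegral_mono_on ((hcont T hT).abs.pow 2).integrableOn_Icc
        ((hui.const_mul 2).add (integrable_const _)) measurableSet_Icc fun x hx => ?_
      have h2 := hi x hx
      rw [Real.dist_eq] at h2
      have h3 : (w x - u i x) ^ 2 ≤ 1 / (T + 1) := by
        rw [← sq_abs]
        refine (pow_le_pow_left₀ (abs_nonneg _) h2.le 2).trans_eq ?_
        rw [div_pow, Real.sq_sqrt (by positivity), one_pow]
      rw [sq_abs, sq_abs]
      nlinarith [sq_nonneg (w x - 2 * u i x)]
    rw [integral_add (hui.const_mul 2) (integrable_const _), integral_const_mul] at h1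
    have h4 : ∫ x in Icc 0 T, |u i x| ^ 2 ≤ M :=
      (setIntegral_mono_set (integrable_sq_of_memLp (hu i).2.1)
        (.of_forall fun _ => by positivity) (LE.le.eventuallyLE (hI.Icc_subset hT))).trans (hm i)
    have h5 : ∫ _ in Icc 0 T, 2 * (1 / (T + 1)) ≤ (2 : ℝ) := by
      simp only [integral_const, MeasurableSet.univ, measureReal_restrict_apply, univ_inter,
        Real.volume_real_Icc, sub_zero, max_eq_left hT0, smul_eq_mul]
      rw [mul_one_div, mul_div_assoc', div_le_iff₀ (by positivity)]
      linarith
    linarith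
  refine ⟨w, ⟨hac, hw2, (memLp_congr_ae hderiv).2 ha⟩, hpt, hunif, fun f hf => ?_⟩
  have : ∫ x in I, f x * deriv w x = ∫ x in I, f x * a x := by
    refine integral_congr_ae ?_
    filter_upwards [hderiv] with x hx
    rw [hx]
  rw [this]
  exact hweak f hf

/-! ### Brezis–Lieb splitting on an edge -/

/-- Every mixed binomial term contains `a b`, and the mixed coefficients add up to `62`. -/
lemma abs_add_pow_six_sub_le {a b S : ℝ} (ha : |a| ≤ S) (hb : |b| ≤ S) :
    |(a + b) ^ 6 - a ^ 6 - b ^ 6| ≤ 62 * S ^ 4 * (|a| * |b|) := by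
  have hS : 0 ≤ S := (abs_nonneg a).trans ha
  have h : (a + b) ^ 6 - a ^ 6 - b ^ 6 =
      (a * b) * (6 * a ^ 4 + 15 * (a ^ 3 * b) + 20 * (a ^ 2 * b ^ 2) + 15 * (a * b ^ 3) + 6 * b ^ 4) := by
    ring
  have hp : ∀ i j : ℕ, i + j = 4 → |a ^ i * b ^ j| ≤ S ^ 4 := by
    intro i j hij
    rw [abs_mul, abs_pow, abs_pow, ← hij, pow_add]
    gcongr
  have h1 := abs_le.1 (hp 4 0 rfl)
  have h2 := abs_le.1 (hp 3 1 rfl)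
  have h3 := abs_le.1 (hp 2 2 rfl)
  have h4 := abs_le.1 (hp 1 3 rfl)
  have h5 := abs_le.1 (hp 0 4 rfl)
  simp only [pow_zero, mul_one, one_mul, pow_one] at h1 h2 h3 h4 h5
  rw [h, abs_mul, abs_mul, mul_comm]
  refine mul_le_mul_of_nonneg_right (abs_le.2 ⟨?_, ?_⟩) (by positivity) <;> linarith [h1.1, h1.2]

/-- With `v = u i - w`, the cross terms vanish: `∫ |w| |v| → 0` controls those for the mass and the
sixth power, and weak convergence handles the derivatives. -/
lemma exists_limit_splitting {ι : Type*} {I : Set ℝ} (hI : IsEdge I) (l : Ultrafilter ι)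
    {u : ι → ℝ → ℝ} (hu : ∀ i, MemSobolev I (u i)) {M : ℝ} (hm : ∀ i, edgeMass I (u i) ≤ M)
    (hd : ∀ i, edgeDerivSq I (u i) ≤ M) :
    ∃ w, MemSobolev I w ∧ (∀ x ∈ I, Tendsto (fun i => u i x) l (𝓝 (w x))) ∧
      Tendsto (fun i => edgeMass I (u i) - edgeMass I w - edgeMass I (u i - w)) l (𝓝 0) ∧
      Tendsto (fun i => edgeDerivSq I (u i) - edgeDerivSq I w - edgeDerivSq I (u i - w)) l (𝓝 0) ∧
      Tendsto (fun i => edgePowSix I (u i) - edgePowSix I w - edgePowSix I (u i - w)) l (𝓝 0) ∧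
      ∀ L, I = Icc 0 L → Tendsto (fun i => edgeMass I (u i - w)) l (𝓝 0) ∧
        Tendsto (fun i => edgePowSix I (u i - w)) l (𝓝 0) := by
  obtain ⟨w, hw, hpt, hunif, hweak⟩ := exists_sobolev_limit hI l hu hm hd
  obtain ⟨K, hK, hsup⟩ := hI.exists_sup_bound
  have hv : ∀ i, MemSobolev I (u i - w) := fun i => (hu i).sub hI hw
  have hsub : ∀ i, u i - w = u i + (-1 : ℝ) • w := fun i => by simp [sub_eq_add_neg]
  have hadd : ∀ i, u i = w + (1 : ℝ) • (u i - w) := fun i => by simp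
  obtain ⟨S, hS, hwS⟩ := hw.exists_bound hI
  have huS : ∀ i, ∀ x ∈ I, |u i x| ≤ √(K * (M + M)) := fun i x hx =>
    Real.abs_le_sqrt ((hsup _ (hu i) x hx).trans (by gcongr; exacts [hm i, hd i]))
  set R := S + √(K * (M + M)) with hR
  have hR0 : 0 ≤ R := by positivity
  have hwR : ∀ x ∈ I, |w x| ≤ R := fun x hx => (hwS x hx).trans (by simp [hR])
  have hvR : ∀ i, ∀ x ∈ I, |(u i - w) x| ≤ R := fun i x hx => by
    rw [Pi.sub_apply]
    exact (abs_sub _ _).trans (by rw [hR]; linarith [huS i x hx, hwS x hx])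
  have hvm : ∀ i, edgeMass I (u i - w) ≤ 2 * M + 2 * edgeMass I w := fun i => by
    have h1 := edgeMass_add_smul (hu i) hw (-1)
    have h2 := edgeMass_add_smul (hu i) hw 1
    have h3 := edgeMass_nonneg I (u i + (1 : ℝ) • w)
    rw [hsub]
    linarith [hm i]
  have hv0 : ∀ T ∈ I, TendstoUniformlyOn (fun i => u i - w) 0 l (Icc 0 T) := fun T hT => by
    have := hunif T hT
    rw [Metric.tendstoUniformlyOn_iff] at this ⊢
    intro ε hε
    filter_upwards [this ε hε] with i hi x hx
    have := hi x hx
    rwa [Pi.zero_apply, dist_zero_left, Pi.sub_apply, ← dist_eq_norm, dist_comm]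
  have hcross := fun {f : ℝ → ℝ} (hf : MemLp f 2 (volume.restrict I)) =>
    tendsto_integral_abs_mul_abs hI hf (fun i => (hv i).2.1) hvm hv0
  have hcw := hcross hw.2.1
  have hwv : ∀ i, Integrable (fun x => |w x| * |(u i - w) x|) (volume.restrict I) := fun i =>
    (integrable_mul_of_memLp hw.2.1 (hv i).2.1).abs.congr (.of_forall fun x => abs_mul _ _)
  refine ⟨w, hw, hpt, ?_, ?_, ?_, ?_⟩
  · have h : Tendsto (fun i => ∫ x in I, w x * (u i - w) x) l (𝓝 0) := by
      refine squeeze_zero_norm (fun i => ?_) hcw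
      refine (norm_integral_le_integral_norm _).trans_eq ?_
      simp only [norm_mul, Real.norm_eq_abs]
    have h2 := h.const_mul 2
    rw [mul_zero] at h2
    refine h2.congr fun i => ?_
    have := edgeMass_add_smul hw (hv i) 1
    rw [← hadd] at this
    linarith
  · have h2 := ((hweak _ hw.2.2).sub_const (∫ x in I, deriv w x * deriv w x)).const_mul 2
    rw [sub_self, mul_zero] at h2
    refine h2.congr fun i => ?_
    have := edgeDerivSq_add_smul hI (hu i) hw (-1)
    rw [← hsub] at this
    have h3 : ∫ x in I, deriv w x * deriv w x = edgeDerivSq I w :=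
      integral_congr_ae (.of_forall fun x => ((sq_abs _).trans (sq _)).symm)
    have h4 : ∫ x in I, deriv w x * deriv (u i) x = ∫ x in I, deriv (u i) x * deriv w x := by
      simp only [mul_comm]
    rw [this, h3, h4]
    ring
  · have h1 := hcw.const_mul (62 * R ^ 4)
    rw [mul_zero] at h1
    refine squeeze_zero_norm (fun i => ?_) h1
    have e1 := (hu i).integrable_pow_six hI
    have e2 := hw.integrable_pow_six hI
    have e3 := (hv i).integrable_pow_six hI
    have e4 : Integrable (fun x => |u i x| ^ 6 - |w x| ^ 6) (volume.restrict I) := e1.sub e2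
    rw [edgePowSix, edgePowSix, edgePowSix, ← integral_sub e1 e2, ← integral_sub e4 e3,
      ← integral_const_mul]
    refine norm_integral_le_of_norm_le ((hwv i).const_mul _) ?_
    filter_upwards [ae_restrict_mem hI.measurableSet] with x hx
    have h := abs_add_pow_six_sub_le (hwR x hx) (hvR i x hx)
    simpa only [Real.norm_eq_abs, Even.pow_abs (show Even 6 by decide), Pi.sub_apply,
      add_sub_cancel] using h
  · rintro L rfl
    -- On a bounded edge the constant `1` is in `L²`, so `∫ |v| → 0`; the uniform bound `R` upgrades
    -- this to higher powers.
    have h1 := hcross (memLp_const (1 : ℝ))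
    simp only [abs_one, one_mul] at h1
    have hv1 : ∀ i, Integrable (fun x => |(u i - w) x|) (volume.restrict (Icc 0 L)) := fun i =>
      ((hv i).2.1.integrable one_le_two).abs
    have key : ∀ (k : ℕ) (i : ι), ∫ x in Icc 0 L, |(u i - w) x| ^ (k + 1) ≤
        R ^ k * ∫ x in Icc 0 L, |(u i - w) x| := by
      intro k i
      rw [← integral_const_mul]
      refine integral_mono_of_nonneg (.of_forall fun x => by positivity)
        ((hv1 i).const_mul _) ?_
      filter_upwards [ae_restrict_mem measurableSet_Icc] with x hx
      rw [pow_succ]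
      gcongr
      exact hvR i x hx
    have h0 : ∀ k : ℕ, Tendsto (fun i => R ^ k * ∫ x in Icc 0 L, |(u i - w) x|) l (𝓝 0) :=
      fun k => by simpa using h1.const_mul (R ^ k)
    exact ⟨squeeze_zero (fun i => edgeMass_nonneg _ _) (key 1) (h0 1),
      squeeze_zero (fun i => edgePowSix_nonneg _ _) (key 5) (h0 5)⟩

/-! ### Adding mass on a half-line at negligible cost -/

lemma memSobolev_of_contDiff {I : Set ℝ} {f : ℝ → ℝ} (hf : ContDiff ℝ 1 f)
    (hc : HasCompactSupport f) : MemSobolev I f :=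
  ⟨fun _ _ => hf.contDiffOn.absolutelyContinuousOnInterval,
    (hf.continuous.memLp_of_hasCompactSupport hc).restrict _,
    ((hf.continuous_deriv le_rfl).memLp_of_hasCompactSupport hc.deriv).restrict _⟩

lemma exists_bump : ∃ b : ℝ → ℝ, ContDiff ℝ 1 b ∧ HasCompactSupport b ∧ b 0 = 0 ∧
    (∀ x, |b x| ≤ 1) ∧ 0 < edgeMass (Ici 0) b := by
  let b : ContDiffBump (1 : ℝ) := ⟨1 / 4, 1 / 2, by norm_num, by norm_num⟩
  have hb1 : ∀ x ∈ Icc (3 / 4 : ℝ) (5 / 4), b x = 1 := fun x hx => b.one_of_mem_closedBall (by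
    rw [Metric.mem_closedBall, Real.dist_eq, abs_le]
    change -(1 / 4) ≤ x - 1 ∧ x - 1 ≤ 1 / 4
    constructor <;> linarith [hx.1, hx.2])
  have hb0 : b 0 = 0 := b.zero_of_le_dist (by
    change 1 / 2 ≤ dist (0 : ℝ) 1
    norm_num)
  have hbc : ContDiff ℝ 1 b := b.contDiff
  have hbs : HasCompactSupport b := b.hasCompactSupport
  have hba : ∀ x, |b x| ≤ 1 := fun x => by
    rw [abs_of_nonneg b.nonneg]
    exact b.le_one
  generalize (b : ℝ → ℝ) = f at *
  refine ⟨f, hbc, hbs, hb0, hba, ?_⟩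
  have hsub : Icc (3 / 4 : ℝ) (5 / 4) ⊆ Ici 0 := fun x hx => mem_Ici.2 (by linarith [hx.1])
  have h1 : ∫ x in Icc (3 / 4 : ℝ) (5 / 4), |f x| ^ 2 ≤ edgeMass (Ici 0) f :=
    setIntegral_mono_set (integrable_sq_of_memLp (memSobolev_of_contDiff hbc hbs).2.1)
      (.of_forall fun _ => by positivity) (LE.le.eventuallyLE hsub)
  have h2 : ∫ x in Icc (3 / 4 : ℝ) (5 / 4), |f x| ^ 2 = ∫ x in Icc (3 / 4 : ℝ) (5 / 4), 1 :=
    setIntegral_congr_fun measurableSet_Icc fun x hx => by simp [hb1 x hx]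
  rw [h2] at h1
  norm_num at h1
  linarith

/-- The mass-preserving dilation `√k b(k x)` of a bump multiplies the derivative integral by `k²`
and the sup norm by `√k`. -/
lemma exists_spreading : ∃ N > 0, ∀ ε > 0, ∃ ψ : ℝ → ℝ, MemSobolev (Ici 0) ψ ∧ ψ 0 = 0 ∧
    edgeMass (Ici 0) ψ = N ∧ edgeDerivSq (Ici 0) ψ ≤ ε ^ 2 ∧ ∀ x, |ψ x| ≤ ε := by
  obtain ⟨b, hbc, hbs, hb0, hba, hN⟩ := exists_bump
  set D := edgeDerivSq (Ici 0) b with hD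
  have hD0 : 0 ≤ D := edgeDerivSq_nonneg _ _
  refine ⟨edgeMass (Ici 0) b, hN, fun ε hε => ?_⟩
  obtain ⟨k, hk0, hk1, hk2⟩ : ∃ k : ℝ, 0 < k ∧ √k ≤ ε ∧ k ^ 2 * D ≤ ε ^ 2 := by
    refine ⟨min (ε ^ 2) (ε / (√D + 1)), by positivity, ?_, ?_⟩
    · rw [Real.sqrt_le_left hε.le]
      exact min_le_left _ _
    · have h1 : min (ε ^ 2) (ε / (√D + 1)) ^ 2 ≤ (ε / (√D + 1)) ^ 2 :=
        pow_le_pow_left₀ (by positivity) (min_le_right _ _) 2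
      calc _ ≤ (ε / (√D + 1)) ^ 2 * D := mul_le_mul_of_nonneg_right h1 hD0
        _ ≤ ε ^ 2 := by
          rw [div_pow, div_mul_eq_mul_div, div_le_iff₀ (by positivity)]
          have := Real.sq_sqrt hD0
          have := Real.sqrt_nonneg D
          gcongr
          nlinarith
  have hcd : ContDiff ℝ 1 fun x => √k * b (k * x) :=
    contDiff_const.mul (hbc.comp (contDiff_const.mul contDiff_id))
  have hcs : HasCompactSupport fun x => √k * b (k * x) := by
    have h : HasCompactSupport (b ∘ Homeomorph.mulLeft₀ k hk0.ne') := hbs.comp_homeomorph _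
    exact h.mul_left (f := fun _ => √k)
  have hscale : ∀ g : ℝ → ℝ, ∫ x in Ici 0, g (k * x) = k⁻¹ * ∫ x in Ici 0, g x := by
    intro g
    rw [integral_Ici_eq_integral_Ioi, integral_Ici_eq_integral_Ioi,
      integral_comp_mul_left_Ioi g 0 hk0, mul_zero, smul_eq_mul]
  refine ⟨fun x => √k * b (k * x), memSobolev_of_contDiff hcd hcs, ?_, ?_, ?_, fun x => ?_⟩
  · simp only [mul_zero, hb0]
  · have h : ∀ x, |√k * b (k * x)| ^ 2 = k * |b (k * x)| ^ 2 := fun x => by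
      rw [abs_mul, mul_pow, sq_abs √k, Real.sq_sqrt hk0.le]
    simp only [edgeMass, h]
    rw [integral_const_mul, hscale fun x => |b x| ^ 2, mul_inv_cancel_left₀ hk0.ne']
  · have h : ∀ x, |deriv (fun x => √k * b (k * x)) x| ^ 2 = k * (k ^ 2 * |deriv b (k * x)| ^ 2) := by
      intro x
      rw [deriv_const_mul_field, deriv_comp_mul_left, smul_eq_mul, abs_mul, abs_mul, mul_pow,
        mul_pow, sq_abs √k, Real.sq_sqrt hk0.le, sq_abs k]
    simp only [edgeDerivSq, h]
    rw [integral_const_mul, integral_const_mul, hscale fun x => |deriv b x| ^ 2]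
    refine le_trans (le_of_eq ?_) hk2
    rw [hD, edgeDerivSq]
    field_simp
  · rw [abs_mul, abs_of_nonneg (Real.sqrt_nonneg k)]
    exact (mul_le_of_le_one_right (Real.sqrt_nonneg k) (hba _)).trans hk1

/-- The sixth power lies above its tangents; the remainder is `b²` times a sum of squares. -/
lemma pow_six_add_mul_le_add_pow_six (a b : ℝ) : a ^ 6 + 6 * a ^ 5 * b ≤ (a + b) ^ 6 := by
  have : (a + b) ^ 6 - (a ^ 6 + 6 * a ^ 5 * b) =
      b ^ 2 * ((b ^ 2 + 3 * a * b + 2 * a ^ 2) ^ 2 + 2 * a ^ 2 * (b + 2 * a) ^ 2 + 3 * a ^ 4) := by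
    ring
  have h : 0 ≤ b ^ 2 * ((b ^ 2 + 3 * a * b + 2 * a ^ 2) ^ 2 + 2 * a ^ 2 * (b + 2 * a) ^ 2
    + 3 * a ^ 4) := by positivity
  linarith

/-- Add `t ψ` with `ψ` flat and widely spread, `t` being tuned to the missing mass. Each first-order
or quadratic loss is proportional to the flatness of `ψ`, and the tangent inequality bounds the
possible loss of `L⁶` norm. -/
lemma exists_add_mass_halfLine {f : ℝ → ℝ} (hf : MemSobolev (Ici 0) f) {κ : ℝ} (hκ : 0 ≤ κ)
    {ε : ℝ} (hε : 0 < ε) : ∃ g, MemSobolev (Ici 0) g ∧ g 0 = f 0 ∧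
      edgeMass (Ici 0) g = edgeMass (Ici 0) f + κ ∧
      1 / 2 * edgeDerivSq (Ici 0) g - 1 / 6 * edgePowSix (Ici 0) g ≤
        1 / 2 * edgeDerivSq (Ici 0) f - 1 / 6 * edgePowSix (Ici 0) f + ε := by
  have hI : IsEdge (Ici 0) := Or.inr rfl
  obtain ⟨N, hN, hψ⟩ := exists_spreading
  have hf5 : IntegrableOn (fun x => f x ^ 5) (Ici 0) := by
    simpa [IntegrableOn] using hf.integrable_pow_mul_pow hI hf (i := 5) (j := 0) 3 rfl
  set D := edgeDerivSq (Ici 0) f with hD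
  have hD0 : 0 ≤ D := edgeDerivSq_nonneg _ _
  set P := ∫ x in Ici 0, |f x ^ 5| with hP
  have hP0 : 0 ≤ P := integral_nonneg fun _ => abs_nonneg _
  set τ := √(κ / N) with hτ
  have hτ0 : 0 ≤ τ := Real.sqrt_nonneg _
  -- Sums the coefficients of `θ` in the energy increase: the derivative cross term, the derivative
  -- square (as `θ² ≤ θ`) and the sixth-power term.
  set Q := τ * √D + τ ^ 2 + τ * P with hQ
  have hQ0 : 0 ≤ Q := by positivity
  set θ := min 1 (ε / (Q + 1)) with hθ
  have hθ0 : 0 < θ := by positivity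
  have hθ1 : θ ≤ 1 := min_le_left _ _
  have hθQ : θ * Q ≤ ε := by
    have h1 : θ * (Q + 1) ≤ ε := (le_div_iff₀ (by positivity)).1 (min_le_right _ _)
    linarith
  -- Replacing `ψ` by `-ψ` if needed makes `J ≥ 0`, hence `t² N ≤ κ`: this bounds `t` by `τ`,
  -- independently of `θ`.
  obtain ⟨ψ, hψS, hψ0, hψN, hψD, hψb, hJ⟩ : ∃ ψ : ℝ → ℝ, MemSobolev (Ici 0) ψ ∧ ψ 0 = 0 ∧
      edgeMass (Ici 0) ψ = N ∧ edgeDerivSq (Ici 0) ψ ≤ θ ^ 2 ∧ (∀ x, |ψ x| ≤ θ) ∧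
      0 ≤ ∫ x in Ici 0, f x * ψ x := by
    obtain ⟨ψ, h1, h2, h3, h4, h5⟩ := hψ θ hθ0
    rcases le_total 0 (∫ x in Ici 0, f x * ψ x) with h | h
    · exact ⟨ψ, h1, h2, h3, h4, h5, h⟩
    · have hneg : deriv (-ψ) = -deriv ψ := by ext x; simp
      refine ⟨-ψ, by simpa using h1.smul hI (-1), by simp [h2], ?_, ?_, by simpa using h5, ?_⟩
      · simpa [edgeMass] using h3
      · simpa [edgeDerivSq, hneg] using h4
      · simpa [integral_neg] using h
  set J := ∫ x in Ici 0, f x * ψ x with hJdef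
  obtain ⟨t, ht0, ht⟩ : ∃ t : ℝ, 0 ≤ t ∧ t ^ 2 * N + 2 * t * J = κ := by
    have hle : J ≤ √(J ^ 2 + κ * N) := Real.le_sqrt_of_sq_le (by nlinarith)
    have hsq : √(J ^ 2 + κ * N) ^ 2 = J ^ 2 + κ * N := Real.sq_sqrt (by positivity)
    refine ⟨(√(J ^ 2 + κ * N) - J) / N, div_nonneg (sub_nonneg.2 hle) hN.le, ?_⟩
    field_simp
    nlinarith
  have htτ : t ≤ τ := Real.le_sqrt_of_sq_le (by
    rw [le_div_iff₀ hN]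
    nlinarith [mul_nonneg ht0 hJ])
  refine ⟨f + t • ψ, hf.add_smul hI hψS t, by simp [hψ0], ?_, ?_⟩
  · rw [edgeMass_add_smul hf hψS, hψN]
    linarith
  · have hE := edgeDerivSq_add_smul hI hf hψS t
    have hA : ∫ x in Ici 0, deriv f x * deriv ψ x ≤ √D * θ := by
      refine le_of_abs_le (abs_le_of_sq_le_sq ?_ (by positivity))
      rw [mul_pow, Real.sq_sqrt hD0]
      exact (sq_integral_mul_le hf.2.2 hψS.2.2).trans (mul_le_mul_of_nonneg_left hψD hD0)
    have hfψ : IntegrableOn (fun x => f x ^ 5 * ψ x) (Ici 0) := by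
      simpa [IntegrableOn] using hf.integrable_pow_mul_pow hI hψS (i := 5) (j := 1) 4 rfl
    have hB : -(P * θ) ≤ ∫ x in Ici 0, f x ^ 5 * ψ x := by
      refine (abs_le.1 ?_).1
      rw [hP, ← integral_mul_const, ← Real.norm_eq_abs]
      refine norm_integral_le_of_norm_le (hf5.abs.mul_const θ) (.of_forall fun x => ?_)
      rw [Real.norm_eq_abs, abs_mul]
      exact mul_le_mul_of_nonneg_left (hψb x) (abs_nonneg _)
    have hC : edgePowSix (Ici 0) f + 6 * t * ∫ x in Ici 0, f x ^ 5 * ψ x ≤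
        edgePowSix (Ici 0) (f + t • ψ) := by
      rw [edgePowSix, edgePowSix, ← integral_const_mul,
        ← integral_add (hf.integrable_pow_six hI) (hfψ.const_mul _)]
      refine integral_mono ((hf.integrable_pow_six hI).add (hfψ.const_mul _))
        ((hf.add_smul hI hψS t).integrable_pow_six hI) fun x => ?_
      have := pow_six_add_mul_le_add_pow_six (f x) (t * ψ x)
      simp only [Even.pow_abs (show Even 6 by decide), Pi.add_apply, Pi.smul_apply, smul_eq_mul]
      linarith
    have h1 : t * ∫ x in Ici 0, deriv f x * deriv ψ x ≤ τ * (√D * θ) :=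
      (mul_le_mul_of_nonneg_left hA ht0).trans (mul_le_mul_of_nonneg_right htτ (by positivity))
    have h2 : -(τ * (P * θ)) ≤ t * ∫ x in Ici 0, f x ^ 5 * ψ x := by
      have := mul_le_mul_of_nonneg_left hB ht0
      have := mul_le_mul_of_nonneg_right htτ (show 0 ≤ P * θ by positivity)
      linarith
    have h3 : t ^ 2 * edgeDerivSq (Ici 0) ψ ≤ τ ^ 2 * θ := by
      refine mul_le_mul (pow_le_pow_left₀ ht0 htτ 2) (hψD.trans ?_) (edgeDerivSq_nonneg _ _)
        (by positivity)
      nlinarith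
    have h4 : 0 ≤ τ ^ 2 * θ := by positivity
    have h5 : θ * Q = τ * (√D * θ) + τ ^ 2 * θ + τ * (P * θ) := by rw [hQ]; ring
    rw [hE]
    linarith

lemma coreMass_eq_sum {V B H : Type*} [Fintype B] (G : MetricGraph V B H) (u : B ⊕ H → ℝ → ℝ) :
    G.coreMass u = ∑ b, edgeMass (G.dom (Sum.inl b)) (u (Sum.inl b)) := rfl

section Graph

variable {V B H : Type*} [Fintype B] [Fintype H] (G : MetricGraph V B H)

lemma mass_eq_sum (u : B ⊕ H → ℝ → ℝ) : G.mass u = ∑ e, edgeMass (G.dom e) (u e) := rfl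

lemma derivSq_eq_sum (u : B ⊕ H → ℝ → ℝ) : G.derivSq u = ∑ e, edgeDerivSq (G.dom e) (u e) := rfl

lemma powSix_eq_sum (u : B ⊕ H → ℝ → ℝ) : G.powSix u = ∑ e, edgePowSix (G.dom e) (u e) := rfl

lemma energy_eq_sum (u : B ⊕ H → ℝ → ℝ) : G.energy u =
    ∑ e, (1 / 2 * edgeDerivSq (G.dom e) (u e) - 1 / 6 * edgePowSix (G.dom e) (u e)) := by
  rw [energy, derivSq_eq_sum, powSix_eq_sum, Finset.sum_sub_distrib, Finset.mul_sum, Finset.mul_sum]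

lemma sum_update {ι α : Type*} [Fintype ι] [DecidableEq ι] (F : ι → α → ℝ) (u : ι → α) (a : ι)
    (g : α) : ∑ e, F e (Function.update u a g e) = ∑ e, F e (u e) + (F a g - F a (u a)) := by
  rw [← Finset.add_sum_erase _ _ (Finset.mem_univ a), ← Finset.add_sum_erase Finset.univ
    (fun e => F e (u e)) (Finset.mem_univ a), Function.update_self]
  have : ∑ x ∈ Finset.univ.erase a, F x (Function.update u a g x) =
      ∑ x ∈ Finset.univ.erase a, F x (u x) :=
    Finset.sum_congr rfl fun x hx => by rw [Function.update_of_ne (Finset.ne_of_mem_erase hx)]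
  rw [this]
  ring

/-- Only one half-line is modified and its vertex value is kept, so continuity and the core are
unaffected. -/
lemma exists_add_mass [Nonempty H] {u : B ⊕ H → ℝ → ℝ} (hu : u ∈ G.H1) {μ : ℝ}
    (hμ : G.mass u ≤ μ) {ε : ℝ} (hε : 0 < ε) :
    ∃ w ∈ G.H1mass μ, G.coreMass w = G.coreMass u ∧ G.energy w ≤ G.energy u + ε := by
  classical
  obtain ⟨h₀⟩ := ‹Nonempty H›
  obtain ⟨g, hg, hg0, hgm, hgE⟩ := exists_add_mass_halfLine (hu.1 (Sum.inr h₀))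
    (sub_nonneg.2 hμ) hε
  refine ⟨Function.update u (Sum.inr h₀) g, ⟨⟨fun e => ?_, ?_⟩, ?_⟩, ?_, ?_⟩
  · rcases eq_or_ne e (Sum.inr h₀) with rfl | he
    · rwa [Function.update_self]
    · rw [Function.update_of_ne he]
      exact hu.1 e
  · obtain ⟨c, hc1, hc2⟩ := hu.2
    refine ⟨c, by simpa using hc1, fun h => ?_⟩
    rcases eq_or_ne h h₀ with rfl | hh
    · rw [Function.update_self, hg0, hc2]
    · rw [Function.update_of_ne (by simpa using hh), hc2]
  · rw [mass_eq_sum, sum_update fun e f => edgeMass (G.dom e) f, ← mass_eq_sum]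
    have : edgeMass (G.dom (Sum.inr h₀)) g = edgeMass (Ici 0) g := rfl
    rw [this, hgm]
    have : edgeMass (G.dom (Sum.inr h₀)) (u (Sum.inr h₀)) = edgeMass (Ici 0) (u (Sum.inr h₀)) := rfl
    linarith
  · simp [coreMass_eq_sum]
  · rw [energy_eq_sum, sum_update fun e f => 1 / 2 * edgeDerivSq (G.dom e) f
      - 1 / 6 * edgePowSix (G.dom e) f, ← energy_eq_sum]
    change _ + (1 / 2 * edgeDerivSq (Ici 0) g - 1 / 6 * edgePowSix (Ici 0) g -
      (1 / 2 * edgeDerivSq (Ici 0) (u (Sum.inr h₀)) - 1 / 6 * edgePowSix (Ici 0) (u (Sum.inr h₀))))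
      ≤ _
    linarith

end Graph

/-! ### Scaling, expansions and Gagliardo–Nirenberg on the graph -/

lemma edgeMass_smul (I : Set ℝ) (f : ℝ → ℝ) (t : ℝ) :
    edgeMass I (t • f) = t ^ 2 * edgeMass I f := by
  rw [edgeMass, edgeMass, ← integral_const_mul]
  refine integral_congr_ae (.of_forall fun x => ?_)
  simp only [Pi.smul_apply, smul_eq_mul, abs_mul, mul_pow, sq_abs]

lemma edgeDerivSq_smul (I : Set ℝ) (f : ℝ → ℝ) (t : ℝ) :
    edgeDerivSq I (t • f) = t ^ 2 * edgeDerivSq I f := by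
  rw [edgeDerivSq, edgeDerivSq, ← integral_const_mul]
  refine integral_congr_ae (.of_forall fun x => ?_)
  simp only [deriv_const_smul_field, smul_eq_mul, abs_mul, mul_pow, sq_abs]

/-- Young's inequality for `f = g - (g - f)`, in the form that the mass of `g + θ⁻¹ (g - f)` is
nonnegative. -/
lemma edgeMass_le_add {I : Set ℝ} (hI : IsEdge I) {f g : ℝ → ℝ} (hf : MemSobolev I f)
    (hg : MemSobolev I g) {θ : ℝ} (hθ : 0 < θ) :
    edgeMass I f ≤ (1 + θ) * edgeMass I g + (1 + θ⁻¹) * edgeMass I (g - f) := by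
  have hv := hg.sub hI hf
  have h1 := edgeMass_add_smul hg hv (-1)
  have h2 := edgeMass_add_smul hg hv θ⁻¹
  have h3 : g + (-1 : ℝ) • (g - f) = f := by simp
  have h4 := mul_nonneg hθ.le (edgeMass_nonneg I (g + θ⁻¹ • (g - f)))
  have h5 : θ * edgeMass I (g + θ⁻¹ • (g - f)) = θ * edgeMass I g +
      2 * (∫ x in I, g x * (g - f) x) + θ⁻¹ * edgeMass I (g - f) := by
    rw [h2]
    field_simp
  rw [h3] at h1
  linarith

lemma edgeMass_eq_zero_of_edgePowSix_eq_zero {I : Set ℝ} (hI : IsEdge I) {f : ℝ → ℝ}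
    (hf : MemSobolev I f) (h : edgePowSix I f = 0) : edgeMass I f = 0 := by
  rw [edgePowSix, integral_eq_zero_iff_of_nonneg (fun _ => by positivity)
    (hf.integrable_pow_six hI)] at h
  refine integral_eq_zero_of_ae ?_
  filter_upwards [h] with x hx
  have : |f x| = 0 := eq_zero_of_pow_eq_zero hx
  simp [this]

section Graph

variable {V B H : Type*} {G : MetricGraph V B H}

lemma add_smul_mem_H1 {u φ : B ⊕ H → ℝ → ℝ} (hu : u ∈ G.H1) (hφ : φ ∈ G.H1) (t : ℝ) :
    u + t • φ ∈ G.H1 := by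
  refine ⟨fun e => (hu.1 e).add_smul (isEdge_dom G e) (hφ.1 e) t, ?_⟩
  obtain ⟨c, hc1, hc2⟩ := hu.2
  obtain ⟨d, hd1, hd2⟩ := hφ.2
  exact ⟨c + t • d, by simp [hc1, hd1], by simp [hc2, hd2]⟩

lemma smul_mem_H1 {u : B ⊕ H → ℝ → ℝ} (hu : u ∈ G.H1) (t : ℝ) : t • u ∈ G.H1 := by
  have : t • u = u + (t - 1) • u := by module
  rw [this]
  exact add_smul_mem_H1 hu hu _

variable [Fintype B]

lemma coreMass_smul (u : B ⊕ H → ℝ → ℝ) (t : ℝ) : G.coreMass (t • u) = t ^ 2 * G.coreMass u := by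
  simp only [coreMass_eq_sum, Pi.smul_apply, edgeMass_smul, Finset.mul_sum]

lemma coreMass_add_smul {u φ : B ⊕ H → ℝ → ℝ} (hu : u ∈ G.H1) (hφ : φ ∈ G.H1) (t : ℝ) :
    G.coreMass (u + t • φ) = G.coreMass u +
      2 * t * (∑ b, ∫ x in G.dom (Sum.inl b), u (Sum.inl b) x * φ (Sum.inl b) x) +
      t ^ 2 * G.coreMass φ := by
  simp only [coreMass_eq_sum, Finset.mul_sum, ← Finset.sum_add_distrib]
  exact Finset.sum_congr rfl fun b _ => edgeMass_add_smul (hu.1 _) (hφ.1 _) t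

lemma coreMass_le_add {u w : B ⊕ H → ℝ → ℝ} (hu : u ∈ G.H1) (hw : w ∈ G.H1) {θ : ℝ}
    (hθ : 0 < θ) :
    G.coreMass u ≤ (1 + θ) * G.coreMass w + (1 + θ⁻¹) * G.coreMass (w - u) := by
  simp only [coreMass_eq_sum, Finset.mul_sum, ← Finset.sum_add_distrib]
  exact Finset.sum_le_sum fun b _ => edgeMass_le_add (isEdge_dom G _) (hu.1 _) (hw.1 _) hθ

variable [Fintype H]

lemma mass_eq_coreMass_add (u : B ⊕ H → ℝ → ℝ) :
    G.mass u = G.coreMass u + ∑ h, edgeMass (Ici 0) (u (Sum.inr h)) :=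
  Fintype.sum_sum_type _

lemma coreMass_le_mass (u : B ⊕ H → ℝ → ℝ) : G.coreMass u ≤ G.mass u := by
  rw [mass_eq_coreMass_add]
  have : 0 ≤ ∑ h, edgeMass (Ici 0) (u (Sum.inr h)) :=
    Finset.sum_nonneg fun _ _ => edgeMass_nonneg _ _
  linarith

lemma derivSq_nonneg (u : B ⊕ H → ℝ → ℝ) : 0 ≤ G.derivSq u :=
  Finset.sum_nonneg fun _ _ => edgeDerivSq_nonneg _ _

lemma powSix_nonneg (u : B ⊕ H → ℝ → ℝ) : 0 ≤ G.powSix u :=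
  Finset.sum_nonneg fun _ _ => edgePowSix_nonneg _ _

lemma mass_nonneg (u : B ⊕ H → ℝ → ℝ) : 0 ≤ G.mass u :=
  Finset.sum_nonneg fun _ _ => edgeMass_nonneg _ _

lemma mass_smul (u : B ⊕ H → ℝ → ℝ) (t : ℝ) : G.mass (t • u) = t ^ 2 * G.mass u := by
  simp only [mass_eq_sum, Pi.smul_apply, edgeMass_smul, Finset.mul_sum]

lemma energy_smul (u : B ⊕ H → ℝ → ℝ) (t : ℝ) :
    G.energy (t • u) = t ^ 2 / 2 * G.derivSq u - t ^ 6 / 6 * G.powSix u := by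
  simp only [energy, derivSq_eq_sum, powSix_eq_sum, Pi.smul_apply, edgeDerivSq_smul,
    edgePowSix_smul, ← Finset.mul_sum]
  ring

lemma mass_add_smul {u φ : B ⊕ H → ℝ → ℝ} (hu : u ∈ G.H1) (hφ : φ ∈ G.H1) (t : ℝ) :
    G.mass (u + t • φ) = G.mass u + 2 * t * G.integral (fun e x => u e x * φ e x) +
      t ^ 2 * G.mass φ := by
  simp only [mass_eq_sum, integral, Finset.mul_sum, ← Finset.sum_add_distrib]
  exact Finset.sum_congr rfl fun b _ => edgeMass_add_smul (hu.1 _) (hφ.1 _) t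

lemma exists_polynomial_derivSq {u φ : B ⊕ H → ℝ → ℝ} (hu : u ∈ G.H1) (hφ : φ ∈ G.H1) :
    ∃ p : Polynomial ℝ, ∀ t : ℝ, G.derivSq (u + t • φ) = p.eval t := by
  refine ⟨∑ e, (Polynomial.C (edgeDerivSq (G.dom e) (u e)) + 2 * Polynomial.X *
    Polynomial.C (∫ x in G.dom e, deriv (u e) x * deriv (φ e) x) +
    Polynomial.X ^ 2 * Polynomial.C (edgeDerivSq (G.dom e) (φ e))), fun t => ?_⟩
  simp only [derivSq_eq_sum, Polynomial.eval_finsetSum, Polynomial.eval_add, Polynomial.eval_mul,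
    Polynomial.eval_C, Polynomial.eval_X, Polynomial.eval_pow, Polynomial.eval_ofNat]
  exact Finset.sum_congr rfl fun e _ =>
    edgeDerivSq_add_smul (isEdge_dom G e) (hu.1 e) (hφ.1 e) t

lemma exists_polynomial_powSix {u φ : B ⊕ H → ℝ → ℝ} (hu : u ∈ G.H1) (hφ : φ ∈ G.H1) :
    ∃ p : Polynomial ℝ, ∀ t : ℝ, G.powSix (u + t • φ) = p.eval t := by
  choose p hp using fun e => exists_polynomial_edgePowSix (isEdge_dom G e) (hu.1 e) (hφ.1 e)
  refine ⟨∑ e, p e, fun t => ?_⟩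
  rw [Polynomial.eval_finsetSum, powSix_eq_sum]
  exact Finset.sum_congr rfl fun e _ => hp e t

lemma coreMass_eq_zero_of_powSix_eq_zero {u : B ⊕ H → ℝ → ℝ} (hu : u ∈ G.H1)
    (h : G.powSix u = 0) : G.coreMass u = 0 := by
  rw [powSix_eq_sum, Finset.sum_eq_zero_iff_of_nonneg fun _ _ => edgePowSix_nonneg _ _] at h
  exact Finset.sum_eq_zero fun b _ => edgeMass_eq_zero_of_edgePowSix_eq_zero (isEdge_dom G _)
    (hu.1 _) (h (Sum.inl b) (Finset.mem_univ _))

lemma exists_gagliardoNirenberg {μ : ℝ} (hμ0 : 0 < μ) (hμ : μ < G.criticalMass) :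
    ∃ C, 0 ≤ C ∧ C * μ ^ 2 < 3 ∧ ∀ u ∈ G.H1, G.powSix u ≤ C * G.mass u ^ 2 * G.derivSq u := by
  have h1 : μ ^ 2 < 3 / G.gnConst := (Real.lt_sqrt hμ0.le).1 hμ
  -- The conventions `3 / 0 = 0` and `sInf ∅ = 0` are harmless: either would give critical mass `0`,
  -- contradicting `0 < μ`.
  have hC : 0 < G.gnConst := by
    by_contra! hC
    have h2 : 3 / G.gnConst ≤ 0 := div_nonpos_of_nonneg_of_nonpos (by norm_num) hC
    nlinarith [sq_nonneg μ]
  have hne : {C : ℝ | 0 ≤ C ∧ ∀ u ∈ G.H1, G.powSix u ≤ C * G.mass u ^ 2 * G.derivSq u}.Nonempty := by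
    rw [nonempty_iff_ne_empty]
    intro h
    rw [gnConst, h, Real.sInf_empty] at hC
    exact lt_irrefl _ hC
  have h3 : G.gnConst < 3 / μ ^ 2 := by
    rw [lt_div_iff₀ hC] at h1
    rw [lt_div_iff₀ (by positivity)]
    linarith
  obtain ⟨C, ⟨hC0, hCu⟩, hC3⟩ := exists_lt_of_csInf_lt hne h3
  exact ⟨C, hC0, (lt_div_iff₀ (by positivity)).1 hC3, hCu⟩

end Graph

lemma exists_gagliardoNirenberg_halfLine {μ : ℝ} (hμ0 : 0 < μ) (hμ : μ < halfLine.criticalMass) :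
    ∃ C, 0 ≤ C ∧ C * μ ^ 2 < 3 ∧ ∀ f, MemSobolev (Ici 0) f →
      edgePowSix (Ici 0) f ≤ C * edgeMass (Ici 0) f ^ 2 * edgeDerivSq (Ici 0) f := by
  obtain ⟨C, hC0, hC, h⟩ := exists_gagliardoNirenberg hμ0 hμ
  refine ⟨C, hC0, hC, fun f hf => ?_⟩
  have hmem : (fun _ : Empty ⊕ Unit => f) ∈ halfLine.H1 := by
    refine ⟨fun e => ?_, fun _ => f 0, fun b => b.elim, fun _ => rfl⟩
    rcases e with e | e
    exacts [e.elim, hf]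
  have := h _ hmem
  simpa [mass_eq_sum, derivSq_eq_sum, powSix_eq_sum, dom] using this

lemma half_sub_sixth_nonneg {C m a d p : ℝ} (hC : 0 ≤ C) (hm : C * m ^ 2 ≤ 3) (ha : 0 ≤ a)
    (ham : a ≤ m) (hd : 0 ≤ d) (hp : p ≤ C * a ^ 2 * d) : 0 ≤ 1 / 2 * d - 1 / 6 * p := by
  have h1 : C * a ^ 2 ≤ 3 := (mul_le_mul_of_nonneg_left (pow_le_pow_left₀ ha ham 2) hC).trans hm
  nlinarith [mul_le_mul_of_nonneg_right h1 hd]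

/-! ### Limits of minimizing sequences and properties of minimizers -/

section Minimization

variable {V B H : Type*} [Fintype B] [Fintype H] {G : MetricGraph V B H}

/-- The remainder loses no energy in the limit: on the core its `L⁶` norm vanishes, and on the
half-lines its mass is eventually subcritical. -/
lemma exists_limit_energy_le {ι : Type*} (l : Ultrafilter ι) {u : ι → B ⊕ H → ℝ → ℝ} {μ η M E : ℝ}
    (hημ : η < μ) (hcore : μ - η < halfLine.criticalMass)
    (hu : ∀ i, u i ∈ G.setA μ η) (hM : ∀ i, G.derivSq (u i) ≤ M)
    (hE : Tendsto (fun i => G.energy (u i)) l (𝓝 E)) :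
    ∃ w ∈ G.H1, G.mass w ≤ μ ∧ η ≤ G.coreMass w ∧ G.energy w ≤ E := by
  have hS : ∀ i e, MemSobolev (G.dom e) (u i e) := fun i e => (hu i).1.1.1 e
  have hm : ∀ e i, edgeMass (G.dom e) (u i e) ≤ max μ M := fun e i => by
    refine le_trans ?_ (le_max_left _ _)
    rw [← (hu i).1.2, mass_eq_sum]
    exact Finset.single_le_sum (f := fun e => edgeMass (G.dom e) (u i e))
      (fun _ _ => edgeMass_nonneg _ _) (Finset.mem_univ e)
  have hd : ∀ e i, edgeDerivSq (G.dom e) (u i e) ≤ max μ M := fun e i => by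
    refine le_trans ?_ ((hM i).trans (le_max_right _ _))
    exact Finset.single_le_sum (f := fun e => edgeDerivSq (G.dom e) (u i e))
      (fun _ _ => edgeDerivSq_nonneg _ _) (Finset.mem_univ e)
  choose w hw hpt hsm hsd hsp hbd using fun e =>
    exists_limit_splitting (isEdge_dom G e) l (fun i => hS i e) (hm e) (hd e)
  have hmass : Tendsto (fun i => ∑ e, edgeMass (G.dom e) (u i e - w e)) l (𝓝 (μ - G.mass w)) := by
    have h := (tendsto_finsetSum Finset.univ fun e _ => hsm e).const_sub (μ - G.mass w)
    rw [Finset.sum_const_zero, sub_zero] at h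
    refine h.congr fun i => ?_
    rw [Finset.sum_sub_distrib, Finset.sum_sub_distrib, ← mass_eq_sum, ← mass_eq_sum, (hu i).1.2]
    ring
  have hcoreT : Tendsto (fun i => G.coreMass (u i)) l (𝓝 (G.coreMass w)) := by
    have h := (tendsto_finsetSum Finset.univ fun b _ =>
      (hsm (Sum.inl b)).add (hbd (Sum.inl b) _ rfl).1).add_const (G.coreMass w)
    simp only [add_zero, Finset.sum_const_zero, zero_add] at h
    refine h.congr fun i => ?_
    rw [coreMass_eq_sum, coreMass_eq_sum, ← Finset.sum_add_distrib]
    exact Finset.sum_congr rfl fun b _ => by ring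
  refine ⟨w, ⟨hw, ?_⟩, ?_, ge_of_tendsto hcoreT (.of_forall fun i => (hu i).2), ?_⟩
  · choose c hcB hcH using fun i => (hu i).1.1.2
    -- Every incident edge end forces this value; at a vertex without edges it may be arbitrary, but
    -- nothing is required there.
    refine ⟨fun v => limUnder l fun i => c i v, fun b => ⟨?_, ?_⟩, fun h => ?_⟩
    · refine (Tendsto.limUnder_eq ((hpt (Sum.inl b) 0 (isEdge_dom G _).zero_mem).congr
        fun i => ?_)).symm
      exact (hcB i b).1
    · refine (Tendsto.limUnder_eq ((hpt (Sum.inl b) (G.len b) ⟨(G.len_pos b).le, le_rfl⟩).congr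
        fun i => ?_)).symm
      exact (hcB i b).2
    · refine (Tendsto.limUnder_eq ((hpt (Sum.inr h) 0 (isEdge_dom G _).zero_mem).congr
        fun i => ?_)).symm
      exact hcH i h
  · have := ge_of_tendsto hmass (.of_forall fun i =>
      Finset.sum_nonneg fun _ _ => edgeMass_nonneg _ _)
    linarith
  · obtain ⟨m, hm1, hm2⟩ := exists_between hcore
    obtain ⟨C, hC0, hCm, hGN⟩ := exists_gagliardoNirenberg_halfLine (by linarith) hm2
    have hvS : ∀ i e, MemSobolev (G.dom e) (u i e - w e) := fun i e =>
      (hS i e).sub (isEdge_dom G e) (hw e)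
    have htail : ∀ᶠ i in l, ∑ h, edgeMass (Ici 0) (u i (Sum.inr h) - w (Sum.inr h)) < m := by
      have h := tendsto_finsetSum Finset.univ fun h _ => hsm (Sum.inr h : B ⊕ H)
      rw [Finset.sum_const_zero] at h
      filter_upwards [h.eventually_const_lt (show μ - η - m < 0 by linarith)] with i hi
      rw [Finset.sum_sub_distrib, Finset.sum_sub_distrib] at hi
      have h1 := mass_eq_coreMass_add (G := G) (u i)
      have h2 := (hu i).1.2
      have h3 := (hu i).2
      have h4 : 0 ≤ ∑ h, edgeMass (Ici 0) (w (Sum.inr h)) :=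
        Finset.sum_nonneg fun _ _ => edgeMass_nonneg _ _
      simp only [dom] at hi
      linarith
    have hrest : Tendsto (fun i => ∑ e, (1 / 2 * edgeDerivSq (G.dom e) (u i e - w e)
        - 1 / 6 * edgePowSix (G.dom e) (u i e - w e))) l (𝓝 (E - G.energy w)) := by
      have h := (hE.sub_const (G.energy w)).sub (tendsto_finsetSum Finset.univ fun e _ =>
        ((hsd e).const_mul (1 / 2)).sub ((hsp e).const_mul (1 / 6)))
      simp only [mul_zero, sub_zero, Finset.sum_const_zero] at h
      refine h.congr fun i => ?_
      rw [energy_eq_sum, energy_eq_sum, ← Finset.sum_sub_distrib, ← Finset.sum_sub_distrib]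
      exact Finset.sum_congr rfl fun e _ => by ring
    have hcoreSix : Tendsto (fun i => -(1 / 6 * ∑ b, edgePowSix (G.dom (Sum.inl b))
        (u i (Sum.inl b) - w (Sum.inl b)))) l (𝓝 0) := by
      have h := ((tendsto_finsetSum Finset.univ fun b _ =>
        (hbd (Sum.inl b) _ rfl).2).const_mul (1 / 6)).neg
      simpa using h
    have hle := le_of_tendsto_of_tendsto hcoreSix hrest (by
      filter_upwards [htail] with i hi
      rw [Fintype.sum_sum_type, Finset.mul_sum, ← Finset.sum_neg_distrib]
      refine (Finset.sum_le_sum fun b _ => ?_).trans (le_add_of_nonneg_right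
        (Finset.sum_nonneg fun h _ => ?_))
      · have := edgeDerivSq_nonneg (G.dom (Sum.inl b)) (u i (Sum.inl b) - w (Sum.inl b))
        linarith
      · refine half_sub_sixth_nonneg hC0 hCm.le (edgeMass_nonneg _ _) (le_trans ?_ hi.le)
          (edgeDerivSq_nonneg _ _) (hGN _ (hvS i (Sum.inr h)))
        exact Finset.single_le_sum
          (f := fun h => edgeMass (Ici 0) (u i (Sum.inr h) - w (Sum.inr h)))
          (fun _ _ => edgeMass_nonneg _ _) (Finset.mem_univ h))
    linarith

/-- In the variable `s`, the squared amplitude, the energy `s D / 2 - s³ P / 6` is strictly concave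
when `P > 0`, so it has no interior minimum at `s = 1`. -/
lemma mass_eq_of_energy_le {u : B ⊕ H → ℝ → ℝ} {μ η : ℝ} (hη : 0 < η)
    (hu : u ∈ G.H1) (hm : G.mass u ≤ μ) (hc : η < G.coreMass u)
    (hmin : ∀ w ∈ G.H1, G.mass w ≤ μ → η ≤ G.coreMass w → G.energy u ≤ G.energy w) :
    G.mass u = μ := by
  by_contra hne
  have hlt : G.mass u < μ := lt_of_le_of_ne hm hne
  have hev : ∀ᶠ h in 𝓝 (0 : ℝ), (1 + h) * G.mass u < μ ∧ η < (1 - h) * G.coreMass u ∧ h < 1 := by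
    refine (((by fun_prop : Continuous fun h : ℝ => (1 + h) * G.mass u).tendsto' 0 _
      (by simp)).eventually_lt_const hlt).and ((((by fun_prop :
      Continuous fun h : ℝ => (1 - h) * G.coreMass u).tendsto' 0 _ (by simp)).eventually_const_lt
      hc).and (eventually_lt_nhds one_pos))
  obtain ⟨h, ⟨h1, h2, h3⟩, h0⟩ := ((hev.filter_mono nhdsWithin_le_nhds).and
    (self_mem_nhdsWithin (s := Ioi (0 : ℝ)))).exists
  replace h0 : 0 < h := h0
  have hscale : ∀ s : ℝ, 0 ≤ s → s * G.mass u ≤ μ → η ≤ s * G.coreMass u →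
      G.energy u ≤ s / 2 * G.derivSq u - s ^ 3 / 6 * G.powSix u := by
    intro s hs hsm hsc
    have hs2 : √s ^ 2 = s := Real.sq_sqrt hs
    have hs6 : √s ^ 6 = s ^ 3 := by
      have : √s ^ 6 = (√s ^ 2) ^ 3 := by ring
      rw [this, hs2]
    have := hmin (√s • u) (smul_mem_H1 hu _) (by rwa [mass_smul, hs2])
      (by rwa [coreMass_smul, hs2])
    rwa [energy_smul, hs2, hs6] at this
  have hm0 := mass_nonneg (G := G) u
  have e1 := hscale (1 + h) (by linarith) h1.le (by nlinarith)
  have e2 := hscale (1 - h) (by linarith) (by nlinarith) h2.le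
  have hP := powSix_nonneg (G := G) u
  have hP0 : G.powSix u = 0 := by
    rw [energy] at e1 e2
    -- Add the inequalities for `1 + h` and `1 - h`, using `(1 + h)³ + (1 - h)³ = 2 + 6 h²`.
    have : h ^ 2 * G.powSix u ≤ 0 := by nlinarith
    have hh : 0 < h ^ 2 := by positivity
    exact le_antisymm (by by_contra! hpos; nlinarith [mul_pos hh hpos]) hP
  have := coreMass_eq_zero_of_powSix_eq_zero hu hP0
  linarith

lemma isConstrainedLocalMin_of_coreMass_lt {u : B ⊕ H → ℝ → ℝ} {μ η : ℝ} (hη : 0 < η)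
    (hu : u ∈ G.H1mass μ) (hc : η < G.coreMass u) (hmin : IsMinOn G.energy (G.setA μ η) u) :
    G.IsConstrainedLocalMin μ u := by
  -- Chosen so that `(1 + θ) η` is the midpoint of `η` and the core mass of `u`; the radius keeps
  -- the other term below half the gap.
  set θ := (G.coreMass u - η) / (2 * η) with hθ
  have hθ0 : 0 < θ := div_pos (sub_pos.2 hc) (by positivity)
  have hr0 : 0 < (G.coreMass u - η) / 2 / (1 + θ⁻¹) :=
    div_pos (half_pos (sub_pos.2 hc)) (by positivity)
  refine ⟨hu, √((G.coreMass u - η) / 2 / (1 + θ⁻¹)), Real.sqrt_pos.2 hr0, fun w hw hr => ?_⟩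
  refine hmin ⟨hw, ?_⟩
  by_contra! hlt
  have h1 := coreMass_le_add hu.1 hw.1 hθ0
  have h2 : G.coreMass (w - u) < (G.coreMass u - η) / 2 / (1 + θ⁻¹) := by
    have h3 := (Real.sqrt_lt_sqrt_iff (add_nonneg (mass_nonneg _) (derivSq_nonneg _))).1 hr
    linarith [coreMass_le_mass (G := G) (w - u), derivSq_nonneg (G := G) (w - u)]
  rw [lt_div_iff₀ (by positivity)] at h2
  have h4 : (1 + θ) * η = (G.coreMass u + η) / 2 := by
    rw [hθ]
    field_simp
    ring
  have h5 : (1 + θ) * G.coreMass w < (1 + θ) * η := mul_lt_mul_of_pos_left hlt (by positivity)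
  linarith

/-- Rescaling `u + t φ` to mass `μ` gives a curve that stays in `A` for small `t`. The squared
factor `σ` is stationary at `0` because `φ` is orthogonal to `u`, so the curve and the line have the
same energy derivative there. -/
lemma isConstrainedCritical_of_coreMass_lt {u : B ⊕ H → ℝ → ℝ} {μ η : ℝ} (hμ : 0 < μ)
    (hu : u ∈ G.H1mass μ) (hc : η < G.coreMass u) (hmin : IsMinOn G.energy (G.setA μ η) u) :
    G.IsConstrainedCritical μ u := by
  refine ⟨hu, fun φ hφ horth => ?_⟩
  obtain ⟨D, hD⟩ := exists_polynomial_derivSq hu.1 hφ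
  obtain ⟨P, hP⟩ := exists_polynomial_powSix hu.1 hφ
  set σ : ℝ → ℝ := fun t => μ / (μ + t ^ 2 * G.mass φ) with hσ
  have hden : ∀ t : ℝ, 0 < μ + t ^ 2 * G.mass φ := fun t =>
    add_pos_of_pos_of_nonneg hμ (mul_nonneg (sq_nonneg t) (mass_nonneg φ))
  have hσ0 : σ 0 = 1 := by simp [hσ, hμ.ne']
  have hσd : HasDerivAt σ 0 0 := by
    have h1 : HasDerivAt (fun t : ℝ => μ + t ^ 2 * G.mass φ) 0 0 := by
      simpa using (((hasDerivAt_id (0 : ℝ)).pow 2).mul_const (G.mass φ)).const_add μ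
    exact ((hasDerivAt_const (0 : ℝ) μ).fun_div h1 (hden 0).ne').congr_deriv (by simp)
  have hDd := D.hasDerivAt 0
  have hPd := P.hasDerivAt 0
  set g : ℝ → ℝ := fun t => σ t / 2 * D.eval t - σ t ^ 3 / 6 * P.eval t with hg
  have hgd : HasDerivAt g (1 / 2 * D.derivative.eval 0 - 1 / 6 * P.derivative.eval 0) 0 := by
    exact (((hσd.div_const 2).fun_mul hDd).fun_sub
      (((hσd.fun_pow 3).div_const 6).fun_mul hPd)).congr_deriv (by simp [hσ0])
  have hEt : ∀ t : ℝ, G.energy (u + t • φ) = 1 / 2 * D.eval t - 1 / 6 * P.eval t := fun t => by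
    rw [energy, hD, hP]
  have hcoreT : Tendsto (fun t : ℝ => σ t * G.coreMass (u + t • φ)) (𝓝 0) (𝓝 (G.coreMass u)) := by
    have h1 : Tendsto (fun t : ℝ => G.coreMass (u + t • φ)) (𝓝 0) (𝓝 (G.coreMass u)) := by
      simp only [coreMass_add_smul hu.1 hφ]
      exact (by fun_prop : Continuous fun t : ℝ => G.coreMass u + 2 * t *
        (∑ b, ∫ x in G.dom (Sum.inl b), u (Sum.inl b) x * φ (Sum.inl b) x) +
        t ^ 2 * G.coreMass φ).tendsto' 0 _ (by simp)
    have h2 : Tendsto σ (𝓝 0) (𝓝 1) := by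
      have := hσd.continuousAt.tendsto
      rwa [hσ0] at this
    simpa using h2.mul h1
  have hmin0 : IsLocalMin g 0 := by
    filter_upwards [hcoreT.eventually_const_lt hc] with t ht
    have hσt : 0 ≤ σ t := div_nonneg hμ.le (hden t).le
    have hs2 : √(σ t) ^ 2 = σ t := Real.sq_sqrt hσt
    have hs6 : √(σ t) ^ 6 = σ t ^ 3 := by
      have : √(σ t) ^ 6 = (√(σ t) ^ 2) ^ 3 := by ring
      rw [this, hs2]
    have hmem : √(σ t) • (u + t • φ) ∈ G.setA μ η := by
      refine ⟨⟨smul_mem_H1 (add_smul_mem_H1 hu.1 hφ t) _, ?_⟩, ?_⟩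
      · rw [mass_smul, hs2, mass_add_smul hu.1 hφ, horth, hu.2, mul_zero, add_zero]
        exact div_mul_cancel₀ _ (hden t).ne'
      · rw [coreMass_smul, hs2]
        exact ht.le
    have h : G.energy u ≤ G.energy (√(σ t) • (u + t • φ)) := hmin hmem
    rw [energy_smul, hs2, hs6, hD, hP] at h
    have h0 := hEt 0
    rw [zero_smul, add_zero] at h0
    simp only [hg, hσ0, one_pow]
    linarith
  have hzero := hmin0.hasDerivAt_eq_zero hgd
  simp only [hEt]
  exact ((hDd.const_mul (1 / 2)).fun_sub (hPd.const_mul (1 / 6))).congr_deriv hzero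

/-- Coercivity: Gagliardo–Nirenberg gives `E(u) ≥ (3 - C μ²) / 6 · ∫ |u'|²`. -/
lemma exists_derivSq_le {μ : ℝ} (hμ0 : 0 < μ) (hμ : μ < G.criticalMass) :
    ∃ c, ∀ u ∈ G.H1mass μ, G.derivSq u ≤ c * G.energy u := by
  obtain ⟨C, hC0, hC, h⟩ := exists_gagliardoNirenberg hμ0 hμ
  refine ⟨6 / (3 - C * μ ^ 2), fun u hu => ?_⟩
  have h1 := h u hu.1
  rw [hu.2] at h1
  rw [div_mul_eq_mul_div, le_div_iff₀ (sub_pos.2 hC), energy]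
  linarith

end Minimization

end MetricGraph

/-! ### The main theorem -/

theorem proposition4 {V B H : Type*} [Finite V] [Fintype B] [Fintype H] [Nonempty B] [Nonempty H]
    (G : MetricGraph V B H) (hG : G.Connected) (μ η δ : ℝ)
    (hη : 0 < η) (hημ : η < μ) (hμ : μ < G.criticalMass) (hδ : 0 < δ)
    (hcore : μ - η < MetricGraph.halfLine.criticalMass) (hδη : (1 + δ) * η < μ)
    (hA : (⊥ : EReal) < ⨅ u ∈ G.setA μ η, (G.energy u : EReal))
    (hAB : (⨅ u ∈ G.setA μ η, (G.energy u : EReal)) <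
      ⨅ u ∈ G.setB μ η δ, (G.energy u : EReal)) :
    ∃ u ∈ G.setA μ η, IsMinOn G.energy (G.setA μ η) u ∧
      G.IsConstrainedLocalMin μ u ∧ G.IsConstrainedCritical μ u := by
  have hμ0 : 0 < μ := hη.trans hημ
  -- The infimum is not `⊥` by `hA` and not `⊤` because it lies strictly below another extended
  -- real.
  obtain ⟨E, hE⟩ : ∃ E : ℝ, ⨅ u ∈ G.setA μ η, (G.energy u : EReal) = E :=
    ⟨_, (EReal.coe_toReal (hAB.trans_le le_top).ne hA.ne').symm⟩
  rw [hE] at hAB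
  have hEle : ∀ u ∈ G.setA μ η, E ≤ G.energy u := fun u hu => by
    have := iInf₂_le (f := fun u (_ : u ∈ G.setA μ η) => (G.energy u : EReal)) u hu
    rw [hE] at this
    exact_mod_cast this
  have hEex : ∀ ε > 0, ∃ u ∈ G.setA μ η, G.energy u < E + ε := fun ε hε => by
    have h : ⨅ u ∈ G.setA μ η, (G.energy u : EReal) < ((E + ε : ℝ) : EReal) := by
      rw [hE]
      exact_mod_cast lt_add_of_pos_right E hε
    simp only [iInf_lt_iff] at h
    obtain ⟨u, hu, h⟩ := h
    exact ⟨u, hu, by exact_mod_cast h⟩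
  obtain ⟨J, hEJ, hJ⟩ := EReal.lt_iff_exists_real_btwn.1 hAB
  have hEJ' : E < J := by exact_mod_cast hEJ
  have hJle : ∀ u ∈ G.setB μ η δ, J ≤ G.energy u := fun u hu => by
    have := hJ.le.trans
      (iInf₂_le (f := fun u (_ : u ∈ G.setB μ η δ) => (G.energy u : EReal)) u hu)
    exact_mod_cast this
  -- Relaxing the mass constraint to `≤ μ` does not lower the infimum, since missing mass costs
  -- arbitrarily little energy.
  have hsub : ∀ w ∈ G.H1, G.mass w ≤ μ → η ≤ G.coreMass w → E ≤ G.energy w := by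
    intro w hw hm hc
    refine le_of_forall_pos_le_add fun ε hε => ?_
    obtain ⟨v, hv, hvc, hvE⟩ := G.exists_add_mass hw hm hε
    exact (hEle v ⟨hv, hc.trans_eq hvc.symm⟩).trans hvE
  choose u huA huE using fun n : ℕ => hEex (1 / (n + 1)) Nat.one_div_pos_of_nat
  have htend : Tendsto (fun n => G.energy (u n)) (hyperfilter ℕ) (𝓝 E) := by
    have h1 : Tendsto (fun n : ℕ => E + 1 / ((n : ℝ) + 1)) atTop (𝓝 E) := by
      simpa using tendsto_one_div_add_atTop_nhds_zero_nat.const_add E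
    exact (tendsto_of_tendsto_of_tendsto_of_le_of_le tendsto_const_nhds h1
      (fun n => hEle _ (huA n)) fun n => (huE n).le).mono_left Nat.hyperfilter_le_atTop
  obtain ⟨c, hc⟩ := MetricGraph.exists_derivSq_le hμ0 hμ
  have hbound : ∀ n, G.derivSq (u n) ≤ |c| * (|E| + 1) := by
    intro n
    refine (hc _ (huA n).1).trans ((le_abs_self _).trans ?_)
    rw [abs_mul]
    refine mul_le_mul_of_nonneg_left (abs_le.2 ⟨?_, ?_⟩) (abs_nonneg c)
    · linarith [hEle _ (huA n), neg_abs_le E]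
    · have : 1 / ((n : ℝ) + 1) ≤ 1 := by
        rw [div_le_one (by positivity)]
        linarith [n.cast_nonneg (α := ℝ)]
      linarith [huE n, le_abs_self E]
  obtain ⟨w, hw, hwm, hwc, hwE⟩ := MetricGraph.exists_limit_energy_le (hyperfilter ℕ) hημ hcore
    huA hbound htend
  -- Otherwise filling up the mass of `w` at cost `(J - E) / 2` would give an element of `B` with
  -- energy below `J`.
  have hwc' : (1 + δ) * η < G.coreMass w := by
    by_contra! hle
    obtain ⟨v, hv, hvc, hvE⟩ := G.exists_add_mass hw hwm (half_pos (sub_pos.2 hEJ'))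
    have := hJle v ⟨hv, hvc ▸ hwc, hvc ▸ hle⟩
    linarith
  have hηc : η < G.coreMass w := lt_trans (by nlinarith) hwc'
  have hmass := MetricGraph.mass_eq_of_energy_le hη hw hwm hηc
    fun v hv hvm hvc => hwE.trans (hsub v hv hvm hvc)
  have hmin : IsMinOn G.energy (G.setA μ η) w := fun v hv => hwE.trans (hEle v hv)
  exact ⟨w, ⟨⟨hw, hmass⟩, hwc⟩, hmin,
    MetricGraph.isConstrainedLocalMin_of_coreMass_lt hη ⟨hw, hmass⟩ hηc hmin,
    MetricGraph.isConstrainedCritical_of_coreMass_lt hμ0 ⟨hw, hmass⟩ hηc hmin⟩
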